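/- Let $GL_0$ be the group of real $2\times 2$ matrices of positive determinant, let $\widetilde{SL}$ be the universal covering group of $SL(2,\mathbf R)$, let $\Gamma\subset\widetilde{SL}$ be a cocompact lattice (a discrete subgroup with compact quotient), let $H$ be the center of $\Gamma$ and $\bar\Gamma=\Gamma/H$. For a representation $\rho:\Gamma\to GL_0$ let $\lambda(\rho):\Gamma\to PGL_0\cong PSL(2,\mathbf R)$ be its projectivisation. Put $L(\gamma)=\frac12\log\det\rho(\gamma)$ and $t(\gamma)=2\log\big(r(\rho(\gamma))/\sqrt{\det\rho(\gamma)}\big)$, where $r$ denotes the spectral radius. The stable norm of a class $c\in H_1(\bar\Gamma,\mathbf Z)$ is $\|c\|=\lim_{n\to\infty}\inf\{t(\gamma)/n : \gamma\in\Gamma \text{ represents } nc\}$. The stable norm of $L$, as an element of $H^1(\bar\Gamma,\mathbf R)$, is the dual norm $\|L\|=\sup_{c}|L(c)|/\|c\|$ over $c\in H_1(\bar\Gamma,\mathbf Z)$ (with $0/0=0$). (For the representations considered here the limit exists and $L$ is trivial on $H$.) The representation $\rho$ is called hyperbolic if (i) the kernel of $\lambda(\rho)$ is $H$; (ii) for every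 $\gamma\in\Gamma$ such that $\gamma^n\notin H$ for all $n\geq 1$, the matrix $\rho(\gamma)$ has two real eigenvalues, one of absolute value $>1$ and one of absolute value $<1$; (iii) $\|L\|<\frac12$. Let $X_0$ be the space of flags $(x,d)$ of $\mathbf RP^2$, where $x$ is a point of $\mathbf R^2\setminus\{0\}\subset\mathbf RP^2$ and $d$ is a projective line that contains $x$ but not the origin $0$ of $\mathbf R^2$. The group $GL_0$ acts on $X_0$ through its linear action on $\mathbf R^2$, extended to $\mathbf RP^2$. **Theorem.** For every hyperbolic representation $\rho:\Gamma\to GL_0$, the action of the (discrete) group $\rho(\Gamma)$ on $X_0$ is free and proper: no non-trivial element of $\rho(\Gamma)$ fixes a point of $X_0$, and for all compact subsets $K,K'\subset X_0$ only finitely many $g\in\rho(\Gamma)$ satisfy $gK\cap K'\neq\emptyset$. -/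

import Mathlib

open scoped MatrixGroups LinearAlgebra.Projectivization Matrix ENNReal UpperHalfPlane
open UpperHalfPlane Filter

noncomputable section

/-! ### The universal covering group of `SL(2, ℝ)` -/

/-- The universal covering group of `SL(2, ℝ)`, in its standard explicit model: pairs of a matrix
`g` in `SL(2, ℝ)` and a continuous logarithm `φ` on the upper half plane of the nonvanishing
automorphy factor `z ↦ c z + d` of `g`. As the half plane is simply connected, such a `φ` exists
for every `g` and is unique up to `2 π i ℤ`. On the rotation subgroup, `φ (i)` is `i` times the
angle, so the loop that generates the fundamental group of `SL(2, ℝ)` lifts to a path whose end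
points differ by a generator of `2 π i ℤ`. -/
def SLTilde : Type :=
  {p : SL(2, ℝ) × C(ℍ, ℂ) // ∀ z : ℍ, Complex.exp (p.2 z) = denom (p.1 : GL (Fin 2) ℝ) z}

namespace SLTilde

/-- The topology is induced by that of `SL(2, ℝ)` and the compact-open topology. -/
instance : TopologicalSpace SLTilde := instTopologicalSpaceSubtype

theorem ext' {a b : SLTilde} (h : a.1.1 = b.1.1) (h' : ∀ z, a.1.2 z = b.1.2 z) : a = b :=
  Subtype.ext (Prod.ext h (ContinuousMap.ext h'))

theorem denom_mul (g h : SL(2, ℝ)) (z : ℍ) :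
    denom ((g * h : SL(2, ℝ)) : GL (Fin 2) ℝ) z =
      denom (g : GL (Fin 2) ℝ) (h • z : ℍ) * denom (h : GL (Fin 2) ℝ) z := by
  have := denom_cocycle_σ (g : GL (Fin 2) ℝ) (h : GL (Fin 2) ℝ) z
  rw [map_mul, this]
  simp [σ]
  rfl

/-- The map of the half plane given by an element of `SL(2, ℝ)`. -/
def act (g : SL(2, ℝ)) : C(ℍ, ℍ) := ⟨fun z => g • z, continuous_const_smul g⟩

/-- `(g, φ) (h, ψ) = (g h, φ ∘ h + ψ)`. -/
instance : Mul SLTilde where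
  mul a b := ⟨(a.1.1 * b.1.1, a.1.2.comp (act b.1.1) + b.1.2), fun z => by
    rw [denom_mul, ContinuousMap.add_apply, Complex.exp_add, b.2, ContinuousMap.comp_apply, a.2]
    rfl⟩

instance : One SLTilde where
  one := ⟨(1, 0), fun z => by simp [denom]⟩

instance : Inv SLTilde where
  inv a := ⟨(a.1.1⁻¹, -(a.1.2.comp (act a.1.1⁻¹))), fun z => by
    have h := denom_mul a.1.1 a.1.1⁻¹ z
    have h1 : denom (((1 : SL(2, ℝ))) : GL (Fin 2) ℝ) z = 1 := by simp [denom]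
    rw [mul_inv_cancel, h1] at h
    simp only [ContinuousMap.neg_apply, ContinuousMap.comp_apply, Complex.exp_neg, a.2]
    exact inv_eq_of_mul_eq_one_right h.symm⟩

theorem mul_snd (a b : SLTilde) (z : ℍ) : (a * b).1.2 z = a.1.2 (b.1.1 • z) + b.1.2 z := rfl

theorem inv_snd (a : SLTilde) (z : ℍ) : a⁻¹.1.2 z = -a.1.2 (a.1.1⁻¹ • z) := rfl

instance : Group SLTilde :=
  Group.ofLeftAxioms
    (fun a b c => ext' (mul_assoc _ _ _) fun z => by
      rw [mul_snd, mul_snd, mul_snd, mul_snd, add_assoc]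
      change _ = a.1.2 ((b.1.1 * c.1.1) • z) + _
      rw [mul_smul])
    (fun a => ext' (one_mul _) fun z => by rw [mul_snd]; exact zero_add _)
    (fun a => ext' (inv_mul_cancel _) fun z => by
      rw [mul_snd, inv_snd, inv_smul_smul]; exact neg_add_cancel _)

theorem continuous_act : Continuous act :=
  ContinuousMap.continuous_of_continuous_uncurry _
    (continuous_smul : Continuous fun p : SL(2, ℝ) × ℍ => p.1 • p.2)

instance : IsTopologicalGroup SLTilde where
  continuous_mul := by
    refine Continuous.subtype_mk (f := fun p : SLTilde × SLTilde =>
      (p.1.1.1 * p.2.1.1, p.1.1.2.comp (act p.2.1.1) + p.2.1.2)) ?_ _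
    have h1 : Continuous fun p : SLTilde × SLTilde => p.1.1 := continuous_subtype_val.comp continuous_fst
    have h2 : Continuous fun p : SLTilde × SLTilde => p.2.1 := continuous_subtype_val.comp continuous_snd
    refine (h1.fst.mul h2.fst).prodMk (Continuous.add ?_ h2.snd)
    exact h1.snd.compCM (continuous_act.comp h2.fst)
  continuous_inv := by
    refine Continuous.subtype_mk (f := fun p : SLTilde =>
      (p.1.1⁻¹, -(p.1.2.comp (act p.1.1⁻¹)))) ?_ _
    have h1 : Continuous fun p : SLTilde => p.1 := continuous_subtype_val
    exact h1.fst.inv.prodMk (h1.snd.compCM (continuous_act.comp h1.fst.inv)).neg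

end SLTilde

/-! ### The space `X₀` of flags -/

/-- The real projective plane. It is also used for the dual plane: a projective line is given by
its covector `d` of homogeneous coordinates, and consists of the points `x` with `x ⬝ d = 0`, that
is, with `x.orthogonal d`. -/
abbrev RP2 : Type := ℙ ℝ (Fin 3 → ℝ)

/-- The quotient topology of `ℝ³ ∖ 0`. -/
instance RP2.instTopologicalSpace : TopologicalSpace RP2 :=
  TopologicalSpace.coinduced (Projectivization.mk' ℝ) inferInstance

/-- The group of `2 × 2` real matrices of positive determinant. -/
abbrev GL0 : Type := GL(2, ℝ)⁺

/-- `A ↦ diag (A, 1)`. -/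
def blockHom : Matrix (Fin 2) (Fin 2) ℝ →* Matrix (Fin 3) (Fin 3) ℝ where
  toFun A := !![A 0 0, A 0 1, 0; A 1 0, A 1 1, 0; 0, 0, 1]
  map_one' := by ext i j; fin_cases i <;> fin_cases j <;> simp
  map_mul' A B := by
    ext i j; fin_cases i <;> fin_cases j <;> simp [Matrix.mul_apply, Fin.sum_univ_succ]

/-- `GL₀` inside the group of projective transformations that preserve the affine plane. -/
def toGL3 : GL0 →* GL (Fin 3) ℝ := (Units.map blockHom).comp (Subgroup.subtype _)

/-- The inverse of the transposed matrix: the action on covectors. -/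
def theta : GL (Fin 3) ℝ →* GL (Fin 3) ℝ where
  toFun g := ⟨(g⁻¹).1ᵀ, g.1ᵀ, by rw [← Matrix.transpose_mul, ← Units.val_mul]; simp,
    by rw [← Matrix.transpose_mul, ← Units.val_mul]; simp⟩
  map_one' := by
    apply Units.ext
    change ((1 : GL (Fin 3) ℝ)⁻¹).1ᵀ = 1
    simp
  map_mul' g h := by
    apply Units.ext
    change ((g * h)⁻¹).1ᵀ = (g⁻¹).1ᵀ * (h⁻¹).1ᵀ
    rw [← Matrix.transpose_mul, ← Units.val_mul, mul_inv_rev]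

/-- The origin of the affine plane, where `(a, b)` in `ℝ²` is the point `[a : b : 1]`. -/
def origin : RP2 := Projectivization.mk ℝ ![0, 0, 1] (by simp)

/-- The line at infinity `{[a : b : c] | c = 0}`. -/
def lineAtInfinity : RP2 := Projectivization.mk ℝ ![0, 0, 1] (by simp)

/-- The flag variety: the pairs of a point `x` and a line `d` through `x`. -/
def flagVariety : Set (RP2 × RP2) := {f | f.1.orthogonal f.2}

/-- The flags `(x, d)` with `x` in `ℝ² ∖ 0` and `d` not containing `0`. -/
def X0 : Set (RP2 × RP2) :=
  {f | f ∈ flagVariety ∧ (¬ f.1.orthogonal lineAtInfinity ∧ f.1 ≠ origin) ∧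
    ¬ origin.orthogonal f.2}

theorem orthogonal_smul (g : GL (Fin 3) ℝ) (x d : RP2) :
    (g • x).orthogonal (theta g • d) ↔ x.orthogonal d := by
  induction x using Projectivization.ind with | h v hv =>
  induction d using Projectivization.ind with | h w hw =>
  rw [Projectivization.smul_mk, Projectivization.smul_mk, Projectivization.orthogonal_mk,
    Projectivization.orthogonal_mk]
  change (g.1 *ᵥ v) ⬝ᵥ ((g⁻¹).1ᵀ *ᵥ w) = 0 ↔ _
  rw [Matrix.mulVec_transpose, dotProduct_comm, ← Matrix.dotProduct_mulVec, Matrix.mulVec_mulVec,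
    ← Units.val_mul, inv_mul_cancel, Units.val_one, Matrix.one_mulVec, dotProduct_comm]

theorem toGL3_smul_origin (g : GL0) : toGL3 g • origin = origin := by
  rw [origin, Projectivization.smul_mk]
  congr 1
  change blockHom g.1.1 *ᵥ ![0, 0, 1] = _
  ext i; fin_cases i <;> simp [blockHom]

theorem theta_smul_lineAtInfinity (g : GL0) :
    theta (toGL3 g) • lineAtInfinity = lineAtInfinity := by
  rw [lineAtInfinity, Projectivization.smul_mk]
  congr 1
  change (blockHom (g⁻¹).1.1)ᵀ *ᵥ ![0, 0, 1] = _
  ext i; fin_cases i <;>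
    simp [blockHom, Matrix.mulVec, dotProduct, Fin.sum_univ_succ]

theorem smul_mem_X0 (g : GL0) {f : RP2 × RP2} (hf : f ∈ X0) :
    (toGL3 g • f.1, theta (toGL3 g) • f.2) ∈ X0 := by
  obtain ⟨h1, ⟨h2, h3⟩, h4⟩ := hf
  refine ⟨(orthogonal_smul _ _ _).2 h1, ⟨?_, fun h => h3 ?_⟩, ?_⟩
  · rw [← theta_smul_lineAtInfinity g]
    exact fun h => h2 ((orthogonal_smul _ _ _).1 h)
  · exact MulAction.injective (toGL3 g) (h.trans (toGL3_smul_origin g).symm)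
  · rw [← toGL3_smul_origin g]
    exact fun h => h4 ((orthogonal_smul _ _ _).1 h)

/-- The projective action of `GL₀` on `X₀`. -/
instance : MulAction GL0 X0 where
  smul g f := ⟨(toGL3 g • f.1.1, theta (toGL3 g) • f.1.2), smul_mem_X0 g f.2⟩
  one_smul f := Subtype.ext (by
    change (toGL3 1 • f.1.1, theta (toGL3 1) • f.1.2) = f.1
    simp)
  mul_smul g h f := Subtype.ext (by
    change (toGL3 (g * h) • f.1.1, theta (toGL3 (g * h)) • f.1.2) =
      (toGL3 g • toGL3 h • f.1.1, theta (toGL3 g) • theta (toGL3 h) • f.1.2)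
    simp [mul_smul])

/-! ### Hyperbolic representations -/

section Hyperbolic

variable {G : Type*} [Group G]

/-- The projectivised linear part, with values in `GL₀` modulo its center (the homotheties),
that is, in `PGL₀ = PSL(2, ℝ)`. -/
def projLinearPart (ρ : G →* GL0) : G →* GL0 ⧸ Subgroup.center GL0 :=
  (QuotientGroup.mk' (Subgroup.center GL0)).comp ρ

/-- The kernel of the projectivised linear part is the center `H`, and every element without
nontrivial power in `H` is mapped to a linear map of saddle type. -/
structure IsHyperbolicRep (ρ : G →* GL0) : Prop where
  ker_eq : (projLinearPart ρ).ker = Subgroup.center G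
  saddle : ∀ γ : G, (∀ n : ℕ, 0 < n → γ ^ n ∉ Subgroup.center G) →
    ∃ a b : ℝ, 1 < |a| ∧ |b| < 1 ∧
      Module.End.HasEigenvalue (Matrix.toLin' (ρ γ).1.1) a ∧
      Module.End.HasEigenvalue (Matrix.toLin' (ρ γ).1.1) b

/-- The logarithm `L` of the homothety factor of `ρ γ`, the square root of its determinant. -/
def logFactor (ρ : G →* GL0) (γ : G) : ℝ :=
  Real.log √(ρ γ).1.1.det

/-- Twice the logarithm of the spectral radius of the unimodular part of `ρ γ`. If this part is
hyperbolic, it is its translation length in the hyperbolic plane, and so the length of the closed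
geodesic of `γ` in the quotient; otherwise it is zero. -/
def geodesicLength (ρ : G →* GL0) (γ : G) : ℝ :=
  2 * Real.log ((spectralRadius ℂ
    ((ρ γ).1.1.map (algebraMap ℝ ℂ))).toReal /
      √(ρ γ).1.1.det)

/-- The first integral homology of `G` modulo its center. -/
abbrev HomologyModCenter (G : Type*) [Group G] : Type _ :=
  Additive (Abelianization (G ⧸ Subgroup.center G))

/-- The homology class of an element. -/
def homologyClass (γ : G) : HomologyModCenter G :=
  Additive.ofMul (Abelianization.of (γ : G ⧸ Subgroup.center G))

/-- The stable norm of an integral homology class `c`: the limit in `n` of the infimum of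
`geodesicLength ρ γ / n` over all `γ` that represent `n c`. (For a cocompact Fuchsian
`projLinearPart ρ` the limit exists, so that it is the lower limit.) -/
def stableNorm (ρ : G →* GL0) (c : HomologyModCenter G) : ℝ :=
  liminf (fun n : ℕ => sInf {s : ℝ | ∃ γ : G, homologyClass γ = n • c ∧
    s = geodesicLength ρ γ / n}) atTop

/-- The stable norm of the class of `logFactor ρ` in the first real cohomology: the dual norm,
i.e. the least `C` with `|L c| ≤ C ‖c‖` for all homology classes `c`. By homogeneity and density it
is enough to take the supremum over integral classes; in `ℝ≥0∞`, `0 / 0 = 0` and `a / 0 = ∞` for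
`a ≠ 0`. -/
def dualStableNorm (ρ : G →* GL0) : ℝ≥0∞ :=
  ⨆ γ : G, ENNReal.ofReal |logFactor ρ γ| / ENNReal.ofReal (stableNorm ρ (homologyClass γ))

end Hyperbolic

end

/-!
Dividing `ρ` by `√det` gives a representation `σ` of `Γ` in `SL(2, ℝ)` whose values are hyperbolic
or of bounded finite order. If `σ Γ` were not discrete, Jørgensen's inequality for elements close to
`1` would force all the hyperbolic values of `σ` to have the same axis. The conjugates of some
`α ∈ Γ` with hyperbolic `σ α` would then form a finite set modulo the center, which is impossible
because the projection of `Γ` to `SL(2, ℝ)` is cocompact and `α` is not central.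

A flag is described by the coordinates of its point and of its line. If `ρ γ` moves a flag within a
compact set, these coordinates bound `‖ρ γ‖` by a multiple of `1 + det (ρ γ)`, which amounts to
`log ‖σ γ‖ ≤ |L γ| + const`. As `|L γ| ≤ ‖L‖ t(γ) ≤ 2 ‖L‖ log ‖σ γ‖` and `‖L‖ < 1 / 2`, the norm of
`σ γ` is bounded, which leaves finitely many `σ γ` and hence finitely many `ρ γ`.

A matrix that fixes a flag fixes a nonzero vector. Since `1` is not an eigenvalue of a saddle, some
power of `γ` is then central, so that `ρ γ` has determinant `1` and trace `2`, and being of finite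
order it is the identity.
-/

open Topology
open scoped Pointwise commutatorElement Matrix.Norms.Operator

/-! ### Discrete and cocompact subgroups -/

section TopologicalGroup

theorem exists_pow_eq_one_of_finite {M : Type*} [Monoid M] {s : Set M} (hs : s.Finite)
    (hfin : ∀ g ∈ s, IsOfFinOrder g) : ∃ n : ℕ, 0 < n ∧ ∀ g ∈ s, g ^ n = 1 := by
  refine ⟨∏ g ∈ hs.toFinset, orderOf g,
    Finset.prod_pos fun g hg ↦ (hfin g (hs.mem_toFinset.1 hg)).orderOf_pos, fun g hg ↦ ?_⟩
  exact orderOf_dvd_iff_pow_eq_one.1 (Finset.dvd_prod_of_mem _ (hs.mem_toFinset.2 hg))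

theorem compactSpace_quotient_map {G G' : Type*} [Group G] [TopologicalSpace G] [Group G']
    [TopologicalSpace G'] (Λ : Subgroup G) [CompactSpace (G ⧸ Λ)] {f : G →* G'} (hf : Continuous f)
    (hsurj : Function.Surjective f) : CompactSpace (G' ⧸ Λ.map f) := by
  have hwell (a b : G) (h : QuotientGroup.leftRel Λ a b) :
      (f a : G' ⧸ Λ.map f) = f b := by
    rw [QuotientGroup.leftRel_apply] at h
    exact QuotientGroup.eq.2 ⟨_, h, by simp⟩
  have hcont : Continuous (Quotient.lift (fun a ↦ (f a : G' ⧸ Λ.map f)) hwell) :=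
    (QuotientGroup.continuous_mk.comp hf).quotient_lift hwell
  refine Function.Surjective.compactSpace (X := G ⧸ Λ) hcont fun q ↦ ?_
  induction q using QuotientGroup.induction_on with | H g =>
  obtain ⟨a, rfl⟩ := hsurj g
  exact ⟨(a : G ⧸ Λ), rfl⟩

variable {G : Type*} [Group G] [TopologicalSpace G] [IsTopologicalGroup G]

theorem discreteTopology_subgroup_iff {Λ : Subgroup G} :
    DiscreteTopology Λ ↔ ∀ᶠ g in 𝓝 (1 : G), g ∈ Λ → g = 1 := by
  rw [discreteTopology_iff_isOpen_singleton_one, isOpen_singleton_iff_nhds_eq_pure, eq_comm,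
    ← (pure_le_nhds (1 : Λ)).ge_iff_eq, le_pure_iff, nhds_subtype_eq_comap]
  change (∀ᶠ a in comap _ _, a = 1) ↔ _
  exact eventually_comap.trans <| eventually_congr <| .of_forall fun g ↦
    ⟨fun h hg ↦ congrArg Subtype.val (h ⟨g, hg⟩ rfl), fun h a ha ↦ Subtype.ext <| by
      rw [ha, h (ha ▸ a.2), Subgroup.coe_one]⟩

theorem finite_inter_of_discreteTopology [T2Space G] (Λ : Subgroup G) [DiscreteTopology Λ]
    {K : Set G} (hK : IsCompact K) : ((Λ : Set G) ∩ K).Finite := by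
  have h := Λ.tendsto_coe_cofinite_of_discrete (isDiscrete_iff_discreteTopology.2 ‹_›)
    hK.compl_mem_cocompact
  rw [mem_map, mem_cofinite, Set.preimage_compl, compl_compl] at h
  exact Subtype.image_preimage_coe _ K ▸ h.image Subtype.val

theorem exists_isCompact_forall_exists_mul_mem [WeaklyLocallyCompactSpace G] (Λ : Subgroup G)
    [CompactSpace (G ⧸ Λ)] : ∃ K : Set G, IsCompact K ∧ ∀ g, ∃ γ ∈ Λ, g * γ ∈ K := by
  choose N hN_compact hN_nhds using fun g : G ↦ exists_compact_mem_nhds g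
  have hcover (q : G ⧸ Λ) : QuotientGroup.mk '' N q.out ∈ 𝓝 q := by
    simpa using (QuotientGroup.isOpenMap_coe (N := Λ)).image_mem_nhds (hN_nhds q.out)
  obtain ⟨t, -, ht⟩ := isCompact_univ.elim_nhds_subcover _ fun q _ ↦ hcover q
  refine ⟨⋃ q ∈ t, N q.out, t.isCompact_biUnion fun q _ ↦ hN_compact _, fun g ↦ ?_⟩
  obtain ⟨q, hq, k, hk, hkg⟩ := Set.mem_iUnion₂.1 (ht (Set.mem_univ (g : G ⧸ Λ)))
  refine ⟨g⁻¹ * k, QuotientGroup.eq.1 hkg.symm, Set.mem_biUnion hq ?_⟩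
  rwa [mul_inv_cancel_left]

theorem exists_pow_eq_one_of_conj_mem [T2Space G] [WeaklyLocallyCompactSpace G] (Λ : Subgroup G)
    [DiscreteTopology Λ] [CompactSpace (G ⧸ Λ)] {C : Set G} (hC : IsCompact C)
    (hconj : ∀ g ∈ Λ, IsOfFinOrder g → ∃ x : G, x * g * x⁻¹ ∈ C) :
    ∃ n : ℕ, 0 < n ∧ ∀ g ∈ Λ, IsOfFinOrder g → g ^ n = 1 := by
  obtain ⟨K, hK, hKΛ⟩ := exists_isCompact_forall_exists_mul_mem Λ
  have hfin := (finite_inter_of_discreteTopology Λ ((hK.inv.mul hC).mul hK)).subset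
    (Set.sep_subset _ IsOfFinOrder)
  obtain ⟨n, hn, hpow⟩ := exists_pow_eq_one_of_finite hfin fun _ hg ↦ hg.2
  refine ⟨n, hn, fun g hg hgfin ↦ ?_⟩
  obtain ⟨x, hx⟩ := hconj g hg hgfin
  obtain ⟨γ, hγ, hxγ⟩ := hKΛ x
  have hmem : γ⁻¹ * g * γ ∈ K⁻¹ * C * K := by
    have heq : γ⁻¹ * g * γ = (x * γ)⁻¹ * (x * g * x⁻¹) * (x * γ) := by group
    rw [heq]
    exact Set.mul_mem_mul (Set.mul_mem_mul (Set.inv_mem_inv.2 hxγ) hx) hxγ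
  have hconj : IsConj g (γ⁻¹ * g * γ) := isConj_iff.2 ⟨γ⁻¹, by rw [inv_inv]⟩
  have hone := hpow _ ⟨⟨Λ.mul_mem (Λ.mul_mem (Λ.inv_mem hγ) hg) hγ, hmem⟩,
    hconj.isOfFinOrder hgfin⟩
  exact isConj_one_right.1 (hone ▸ (hconj.pow n).symm)

end TopologicalGroup

/-! ### Cocompact subgroups of the special linear group -/

section Center

variable {R n : Type*} [CommRing R] [Fintype n] [DecidableEq n]

theorem commute_coe_specialLinearGroup_iff {g h : Matrix.SpecialLinearGroup n R} :
    Commute g.1 h.1 ↔ Commute g h :=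
  (Subtype.ext_iff (a1 := g * h) (a2 := h * g)).symm

theorem coe_mem_range_scalar_iff_mem_center {g : Matrix.SpecialLinearGroup n R} :
    g.1 ∈ Set.range (Matrix.scalar n) ↔
      g ∈ Subgroup.center (Matrix.SpecialLinearGroup n R) := by
  refine ⟨fun ⟨r, hr⟩ ↦ Subgroup.mem_center_iff.2 fun h ↦ Subtype.ext ?_, fun h ↦ ?_⟩
  · change h.1 * g.1 = g.1 * h.1
    rw [← hr]
    exact (Matrix.scalar_commute r (Commute.all r) h.1).symm
  · obtain ⟨r, -, hr⟩ := Matrix.SpecialLinearGroup.mem_center_iff.1 h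
    exact ⟨r, hr⟩

theorem pow_card_eq_one_of_mem_center {g : Matrix.SpecialLinearGroup n R}
    (hg : g ∈ Subgroup.center (Matrix.SpecialLinearGroup n R)) :
    g ^ Fintype.card n = 1 := by
  obtain ⟨r, hr, hrg⟩ := Matrix.SpecialLinearGroup.mem_center_iff.1 hg
  refine Subtype.ext ?_
  rw [Matrix.SpecialLinearGroup.coe_pow, ← hrg, ← map_pow, hr, map_one]
  rfl

theorem finite_center_specialLinearGroup [IsDomain R] :
    (Subgroup.center (Matrix.SpecialLinearGroup n R) :
      Set (Matrix.SpecialLinearGroup n R)).Finite := by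
  cases isEmpty_or_nonempty n
  · exact Set.toFinite _
  · have : Finite (Subgroup.center (Matrix.SpecialLinearGroup n R)) := .of_equiv _
      (Matrix.SpecialLinearGroup.center_equiv_rootsOfUnity' (Classical.arbitrary n)).symm.toEquiv
    exact this

end Center

section SpecialLinearGroup

open Matrix.SpecialLinearGroup (transvection transvection_coe)

theorem commute_of_bounded_conj_one_add_smul {A : Type*} [NormedRing A] [NormedAlgebra ℝ A]
    {N x : A} {C : ℝ} (hC : ∀ t : ℝ, ‖(1 + t • N) * x * (1 - t • N)‖ ≤ C) :
    Commute N x := by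
  have hdiff (t : ℝ) : (1 + t • N) * x * (1 - t • N) - (1 - t • N) * x * (1 + t • N) =
      (2 * t) • (N * x - x * N) := by
    simp only [add_mul, sub_mul, mul_add, mul_sub, one_mul, mul_one, smul_mul_assoc,
      mul_smul_comm]
    module
  have hbound (t : ℝ) : |2 * t| * ‖N * x - x * N‖ ≤ 2 * C := by
    rw [← Real.norm_eq_abs, ← norm_smul, ← hdiff]
    have hneg := hC (-t)
    rw [neg_smul t N, ← sub_eq_add_neg, sub_neg_eq_add] at hneg
    linarith [norm_sub_le ((1 + t • N) * x * (1 - t • N)) ((1 - t • N) * x * (1 + t • N)), hC t]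
  by_contra hne
  have hpos : 0 < ‖N * x - x * N‖ := norm_pos_iff.2 (sub_ne_zero.2 hne)
  have hle := (mul_le_mul_of_nonneg_right (le_abs_self _) hpos.le).trans
    (hbound ((C + 1) / ‖N * x - x * N‖))
  rw [mul_assoc, div_mul_cancel₀ _ hpos.ne'] at hle
  linarith

variable {n : Type*} [Fintype n] [DecidableEq n]

instance : LocallyCompactSpace (Matrix.SpecialLinearGroup n ℝ) :=
  haveI : LocallyCompactSpace (Matrix n n ℝ) := inferInstanceAs (LocallyCompactSpace (n → n → ℝ))
  Matrix.SpecialLinearGroup.isClosedEmbedding_val.locallyCompactSpace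

theorem mem_range_scalar_of_bounded_conj {x : Matrix n n ℝ} {C : ℝ}
    (hC : ∀ g : Matrix.SpecialLinearGroup n ℝ, ‖g.1 * x * (g⁻¹).1‖ ≤ C) :
    x ∈ Set.range (Matrix.scalar n) := by
  refine Matrix.mem_range_scalar_of_commute_single fun i j hij ↦ ?_
  refine commute_of_bounded_conj_one_add_smul (C := C) fun t ↦ ?_
  have hinv : (transvection hij t)⁻¹ = transvection hij (-t) :=
    inv_eq_of_mul_eq_one_right <| Subtype.ext <|
      (Matrix.transvection_mul_transvection_same i j hij t (-t)).trans (by simp)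
  simpa [hinv, transvection_coe, Matrix.smul_single, sub_eq_add_neg, ← Matrix.single_neg]
    using hC (transvection hij t)

variable (Λ : Subgroup (Matrix.SpecialLinearGroup n ℝ))
  [CompactSpace (Matrix.SpecialLinearGroup n ℝ ⧸ Λ)]

theorem mem_range_scalar_of_bounded_conj_of_cocompact {x : Matrix n n ℝ} {C : ℝ}
    (hC : ∀ g ∈ Λ, ‖g.1 * x * (g⁻¹).1‖ ≤ C) : x ∈ Set.range (Matrix.scalar n) := by
  obtain ⟨K, hK, hKΛ⟩ := exists_isCompact_forall_exists_mul_mem Λ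
  obtain ⟨B, hB⟩ := hK.exists_bound_of_continuousOn (f := Subtype.val) (by fun_prop)
  obtain ⟨B', hB'⟩ := hK.inv.exists_bound_of_continuousOn (f := Subtype.val) (by fun_prop)
  refine mem_range_scalar_of_bounded_conj (C := B * C * B') fun g ↦ ?_
  obtain ⟨γ, hγ, hk⟩ := hKΛ g
  obtain ⟨k, rfl⟩ : ∃ k, g = k * γ⁻¹ := ⟨g * γ, (mul_inv_cancel_right g γ).symm⟩
  rw [inv_mul_cancel_right] at hk
  calc ‖(k * γ⁻¹).1 * x * ((k * γ⁻¹)⁻¹).1‖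
      = ‖k.1 * ((γ⁻¹).1 * x * (γ⁻¹⁻¹).1) * (k⁻¹).1‖ := by
        simp only [mul_inv_rev, Matrix.SpecialLinearGroup.coe_mul, mul_assoc]
    _ ≤ ‖k.1‖ * ‖(γ⁻¹).1 * x * (γ⁻¹⁻¹).1‖ * ‖(k⁻¹).1‖ := norm_mul₃_le
    _ ≤ B * C * B' := by
      have hBk := hB _ hk
      have hBk' := hB' _ (Set.inv_mem_inv.2 hk)
      have hCγ := hC _ (Λ.inv_mem hγ)
      have hB0 := (norm_nonneg _).trans hBk
      have hC0 := (norm_nonneg _).trans hCγ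
      gcongr

theorem mem_center_of_finite_conj_of_cocompact {a : Matrix.SpecialLinearGroup n ℝ}
    (ha : {b | ∃ g ∈ Λ, g * a * g⁻¹ = b}.Finite) :
    a ∈ Subgroup.center (Matrix.SpecialLinearGroup n ℝ) := by
  obtain ⟨C, hC⟩ := (ha.image fun b ↦ ‖b.1‖).bddAbove
  exact coe_mem_range_scalar_iff_mem_center.1 <|
    mem_range_scalar_of_bounded_conj_of_cocompact Λ fun g hg ↦ hC ⟨_, ⟨g, hg, rfl⟩, by simp⟩

theorem mem_center_of_forall_commute_of_cocompact {a : Matrix.SpecialLinearGroup n ℝ}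
    (ha : ∀ g ∈ Λ, Commute g a) : a ∈ Subgroup.center (Matrix.SpecialLinearGroup n ℝ) := by
  refine mem_center_of_finite_conj_of_cocompact Λ ((Set.finite_singleton a).subset ?_)
  rintro b ⟨g, hg, rfl⟩
  exact (ha g hg).mul_inv_cancel

end SpecialLinearGroup

/-! ### Two by two matrices -/

section FinTwo

theorem notMem_range_scalar_of_discr_ne_zero {R : Type*} [CommRing R]
    {A : Matrix (Fin 2) (Fin 2) R} (hA : A.discr ≠ 0) : A ∉ Set.range (Matrix.scalar (Fin 2)) := by
  rintro ⟨r, rfl⟩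
  rw [Matrix.discr_fin_two, Matrix.trace_fin_two, Matrix.det_fin_two] at hA
  exact hA (by simp; ring)

theorem trace_ne_zero_of_isHyperbolic {A : SL(2, ℝ)} (hA : A.1.IsHyperbolic) :
    A.1.trace ≠ 0 := by
  intro htr
  rw [Matrix.IsHyperbolic, Matrix.discr_fin_two, htr, A.2] at hA
  norm_num at hA

theorem exists_eq_smul_one_add_smul_of_commute {K : Type*} [Field K]
    {A C : Matrix (Fin 2) (Fin 2) K} (hA : A ∉ Set.range (Matrix.scalar (Fin 2)))
    (hC : Commute C A) : ∃ p q : K, C = p • 1 + q • A := by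
  have hentries := hC.eq
  rw [← Matrix.ext_iff] at hentries
  simp only [Fin.forall_fin_two, Matrix.mul_apply, Fin.sum_univ_two] at hentries
  obtain ⟨⟨h00, h01⟩, h10, _⟩ := hentries
  obtain ⟨q, hq01, hq10, hqdiag⟩ : ∃ q : K, C 0 1 = q * A 0 1 ∧ C 1 0 = q * A 1 0 ∧
      C 0 0 - C 1 1 = q * (A 0 0 - A 1 1) := by
    by_cases h01' : A 0 1 = 0
    · by_cases h10' : A 1 0 = 0
      · have hdiag : A 0 0 - A 1 1 ≠ 0 := by
          refine fun hdiag ↦ hA ⟨A 0 0, ?_⟩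
          ext i j
          fin_cases i <;> fin_cases j <;> simp [h01', h10', sub_eq_zero.1 hdiag]
        refine ⟨(C 0 0 - C 1 1) / (A 0 0 - A 1 1), ?_, ?_, ?_⟩ <;> field_simp <;> grind
      · refine ⟨C 1 0 / A 1 0, ?_, ?_, ?_⟩ <;> field_simp <;> grind
    · refine ⟨C 0 1 / A 0 1, ?_, ?_, ?_⟩ <;> field_simp <;> grind
  refine ⟨C 0 0 - q * A 0 0, q, ?_⟩
  ext i j
  fin_cases i <;> fin_cases j <;> simp [hq01, hq10]
  linear_combination -hqdiag

theorem commute_of_commute_of_notMem_range_scalar {K : Type*} [Field K]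
    {A B C : Matrix (Fin 2) (Fin 2) K} (hA : A ∉ Set.range (Matrix.scalar (Fin 2)))
    (hB : Commute B A) (hC : Commute C A) : Commute B C := by
  obtain ⟨p, q, rfl⟩ := exists_eq_smul_one_add_smul_of_commute hA hB
  exact ((Commute.one_left C).smul_left p).add_left (hC.symm.smul_left q)

theorem eq_or_eq_adjugate_of_commute {K : Type*} [Field K] [NeZero (2 : K)]
    {A C : Matrix (Fin 2) (Fin 2) K} (hA : A.discr ≠ 0) (hC : Commute C A)
    (htr : C.trace = A.trace) (hdet : C.det = A.det) : C = A ∨ C = A.adjugate := by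
  obtain ⟨p, q, rfl⟩ :=
    exists_eq_smul_one_add_smul_of_commute (notMem_range_scalar_of_discr_ne_zero hA) hC
  have h2 : (2 : K) ≠ 0 := two_ne_zero
  rw [Matrix.trace_fin_two, Matrix.trace_fin_two] at htr
  rw [Matrix.det_fin_two, Matrix.det_fin_two] at hdet
  rw [Matrix.discr_fin_two, Matrix.trace_fin_two, Matrix.det_fin_two] at hA
  simp only [Matrix.add_apply, Matrix.smul_apply, smul_eq_mul, Matrix.one_apply_eq, ne_eq,
    zero_ne_one, one_ne_zero, not_false_eq_true, Matrix.one_apply_ne, mul_one, mul_zero,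
    zero_add] at htr hdet
  have hp : 2 * p = (1 - q) * (A 0 0 + A 1 1) := by linear_combination htr
  have hq : (1 - q) * (1 + q) = 0 := by
    refine (mul_eq_zero.1 ?_).resolve_right hA
    linear_combination 4 * hdet - (2 * p + (1 + q) * (A 0 0 + A 1 1)) * hp
  rcases mul_eq_zero.1 hq with hq | hq
  · left
    obtain rfl : q = 1 := (sub_eq_zero.1 hq).symm
    obtain rfl : p = 0 := by simpa [h2] using hp
    simp
  · right
    obtain rfl : q = -1 := (neg_eq_of_add_eq_zero_right hq).symm
    obtain rfl : p = A 0 0 + A 1 1 := mul_left_cancel₀ h2 (by linear_combination hp)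
    rw [Matrix.adjugate_fin_two]
    ext i j
    fin_cases i <;> fin_cases j <;> simp

theorem trace_eq_zero_of_mul_eq_adjugate_mul {K : Type*} [Field K]
    {A B : Matrix (Fin 2) (Fin 2) K} (hA : A ∉ Set.range (Matrix.scalar (Fin 2)))
    (h : B * A = A.adjugate * B) : B.trace = 0 := by
  by_contra hB
  rw [Matrix.adjugate_fin_two, ← Matrix.ext_iff] at h
  simp only [Fin.forall_fin_two, Matrix.mul_apply, Fin.sum_univ_two, Matrix.of_apply,
    Matrix.cons_val', Matrix.cons_val_zero, Matrix.cons_val_one, Matrix.cons_val_fin_one] at h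
  obtain ⟨⟨h00, h01⟩, h10, h11⟩ := h
  rw [Matrix.trace_fin_two] at hB
  have hA01 : A 0 1 = 0 := mul_left_cancel₀ hB (by linear_combination h01)
  have hA10 : A 1 0 = 0 := mul_left_cancel₀ hB (by linear_combination h10)
  have hdiag : A 0 0 = A 1 1 := mul_left_cancel₀ hB (by linear_combination h00 - h11)
  refine hA ⟨A 0 0, ?_⟩
  ext i j
  fin_cases i <;> fin_cases j <;> simp [hA01, hA10, hdiag]

end FinTwo

/-! ### Elements of finite order of the special linear group -/

section FiniteOrder

theorem exists_pow_eq_one_and_trace_eq {K L : Type*} [Field K] [Field L] [IsAlgClosed L]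
    [Algebra K L] {B : Matrix (Fin 2) (Fin 2) K} (hdet : B.det = 1) {m : ℕ} (hm : B ^ m = 1) :
    ∃ μ : L, μ ^ m = 1 ∧ algebraMap K L B.trace = μ + μ⁻¹ := by
  set C := (algebraMap K L).mapMatrix B with hC
  have hCm : C ^ m = 1 := by rw [hC, ← map_pow, hm, map_one]
  obtain ⟨μ, hμ⟩ := IsAlgClosed.exists_root C.charpoly
    (by rw [Matrix.charpoly_degree_eq_dim]; simp)
  have hpow : μ ^ m ∈ spectrum L (C ^ m) :=
    spectrum.pow_mem_pow C m (Matrix.mem_spectrum_iff_isRoot_charpoly.2 hμ)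
  rw [hCm, spectrum.one_eq] at hpow
  have hCtr : C.trace = algebraMap K L B.trace := (AddMonoidHom.map_trace _ _).symm
  have hCdet : C.det = 1 := by rw [hC, ← RingHom.map_det, hdet, map_one]
  have hroot : μ ^ 2 - algebraMap K L B.trace * μ + 1 = 0 := by
    simpa [Polynomial.IsRoot, Matrix.charpoly_fin_two, hCtr, hCdet] using hμ
  have hμ0 : μ ≠ 0 := by
    rintro rfl
    simp at hroot
  refine ⟨μ, hpow, ?_⟩
  field_simp
  linear_combination -hroot

theorem eq_one_of_isOfFinOrder_of_trace_eq_two {K : Type*} [Field K] [CharZero K] {g : SL(2, K)}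
    (hg : IsOfFinOrder g) (htr : g.1.trace = 2) : g = 1 := by
  obtain ⟨n, hn, hgn⟩ := isOfFinOrder_iff_pow_eq_one.1 hg
  have hscalar : g.1 ∈ Set.range (Matrix.scalar (Fin 2)) := by
    by_contra hns
    have hpar : (g : GL (Fin 2) K).IsParabolic :=
      ⟨hns, by rw [Matrix.discr_fin_two]; simp [htr]; norm_num⟩
    refine (hpar.pow hn.ne').1 ⟨1, ?_⟩
    rw [← map_pow, hgn]
    simp
  obtain ⟨r, hr⟩ := hscalar
  obtain rfl : r = 1 := by
    rw [← hr, Matrix.trace_fin_two] at htr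
    refine mul_left_cancel₀ (two_ne_zero (α := K)) ?_
    simpa [two_mul] using htr
  exact Subtype.ext (by rw [← hr, map_one]; rfl)

theorem abs_trace_le_two_of_isOfFinOrder {g : SL(2, ℝ)} (hg : IsOfFinOrder g) :
    |g.1.trace| ≤ 2 := by
  obtain ⟨n, hn, hgn⟩ := isOfFinOrder_iff_pow_eq_one.1 hg
  obtain ⟨μ, hμ, htr⟩ := exists_pow_eq_one_and_trace_eq (L := ℂ) g.2
    (by rw [← Matrix.SpecialLinearGroup.coe_pow, hgn]; rfl)
  have hnorm : ‖μ‖ = 1 := Complex.norm_eq_one_of_pow_eq_one hμ hn.ne'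
  calc |g.1.trace| = ‖(algebraMap ℝ ℂ) g.1.trace‖ := by simp
    _ = ‖μ + μ⁻¹‖ := by rw [htr]
    _ ≤ ‖μ‖ + ‖μ⁻¹‖ := norm_add_le _ _
    _ = 2 := by rw [norm_inv, hnorm]; norm_num

theorem isElliptic_of_isOfFinOrder {g : SL(2, ℝ)} (hg : IsOfFinOrder g)
    (hc : g ∉ Subgroup.center SL(2, ℝ)) : g.1.IsElliptic := by
  have hle := abs_trace_le_two_of_isOfFinOrder hg
  have hne : g.1.trace ≠ 2 := fun htr ↦ hc <| by
    rw [eq_one_of_isOfFinOrder_of_trace_eq_two hg htr]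
    exact one_mem _
  have hne' : g.1.trace ≠ -2 := fun htr ↦ hc <| by
    have hneg : -g = 1 := by
      refine eq_one_of_isOfFinOrder_of_trace_eq_two ?_ (by simp [htr])
      rw [← neg_one_mul]
      exact (Commute.neg_one_left g).isOfFinOrder_mul
        (isOfFinOrder_iff_pow_eq_one.2 ⟨2, two_pos, neg_one_sq⟩) hg
    rw [← neg_neg g, hneg, Subgroup.mem_center_iff]
    exact fun h ↦ ((Commute.neg_one_right h).eq)
  rw [Matrix.IsElliptic, Matrix.discr_fin_two, g.2, mul_one]
  nlinarith [abs_le.1 hle, lt_of_le_of_ne (abs_le.1 hle).1 hne'.symm,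
    lt_of_le_of_ne (abs_le.1 hle).2 hne]

theorem exists_trace_gap_of_pow_eq_one {m : ℕ} (hm : 0 < m) :
    ∃ ε > 0, ∀ g : SL(2, ℝ), g ^ m = 1 → |g.1.trace - 2| < ε → g = 1 := by
  set S : Set ℝ := (fun μ : ℂ ↦ (μ + μ⁻¹).re) '' {μ | μ ^ m = 1}
  have hSfin : S.Finite := by
    refine Set.Finite.image _ ?_
    refine (Polynomial.nthRoots m (1 : ℂ)).toFinset.finite_toSet.subset fun μ hμ ↦ ?_
    simpa [Polynomial.mem_nthRoots hm] using hμ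
  have hopen : (S \ {2})ᶜ ∈ 𝓝 (2 : ℝ) :=
    (hSfin.subset Set.sdiff_subset).isClosed.isOpen_compl.mem_nhds (by simp)
  obtain ⟨ε, hε, hball⟩ := Metric.mem_nhds_iff.1 hopen
  refine ⟨ε, hε, fun g hgm htr ↦ ?_⟩
  obtain ⟨μ, hμ, hμtr⟩ := exists_pow_eq_one_and_trace_eq (L := ℂ) g.2
    (by rw [← Matrix.SpecialLinearGroup.coe_pow, hgm]; rfl)
  refine eq_one_of_isOfFinOrder_of_trace_eq_two (isOfFinOrder_iff_pow_eq_one.2 ⟨m, hm, hgm⟩) ?_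
  by_contra hne
  refine hball (show g.1.trace ∈ Metric.ball 2 ε from htr) ⟨⟨μ, hμ, ?_⟩, hne⟩
  simp only [← hμtr, Complex.coe_algebraMap, Complex.ofReal_re]

theorem exists_smul_eq_self_of_isOfFinOrder {g : SL(2, ℝ)} (hg : IsOfFinOrder g) :
    ∃ z : ℍ, g • z = z := by
  by_cases hc : g ∈ Subgroup.center SL(2, ℝ)
  · obtain ⟨r, -, hr⟩ := Matrix.SpecialLinearGroup.mem_center_iff.1 hc
    have hmem : (g : GL (Fin 2) ℝ) ∈ Subgroup.center (GL (Fin 2) ℝ) :=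
      Matrix.GeneralLinearGroup.mem_center_iff_val_mem_range_scalar.2 ⟨r, hr⟩
    exact ⟨I, forall_smul_eq_self_iff_mem_center.2 hmem I⟩
  · have hell : (g : GL (Fin 2) ℝ).IsElliptic := isElliptic_of_isOfFinOrder hg hc
    exact ⟨fixedPt _ hell, (gl_smul_eq_self_iff_eq_fixedPt (by simp) hell).2 rfl⟩

theorem exists_pow_eq_one_of_cocompact (Λ : Subgroup SL(2, ℝ)) [DiscreteTopology Λ]
    [CompactSpace (SL(2, ℝ) ⧸ Λ)] :
    ∃ n : ℕ, 0 < n ∧ ∀ g ∈ Λ, IsOfFinOrder g → g ^ n = 1 := by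
  refine exists_pow_eq_one_of_conj_mem Λ
    (isProperMap_smul_I.isCompact_preimage (isCompact_singleton (x := I))) fun g _ hg ↦ ?_
  obtain ⟨z, hz⟩ := exists_smul_eq_self_of_isOfFinOrder hg
  obtain ⟨x, hx⟩ := MulAction.exists_smul_eq SL(2, ℝ) z I
  refine ⟨x, ?_⟩
  rw [Set.mem_preimage, Set.mem_singleton_iff, ← hx, mul_smul, inv_smul_smul, mul_smul, hz]

end FiniteOrder

/-! ### Jørgensen's inequality -/

section Jorgensen

/-- The failure `2 - tr [A, g]` of the commutator of `A` and `g` to be unipotent. It vanishes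
exactly when `A` and `g` have a common eigenvector over an algebraically closed field, and it is
the quantity that shrinks when `g` is replaced by `g * A * g⁻¹` in the proof of Jørgensen's
inequality. -/
def commDefect {R : Type*} [CommRing R] (A g : SL(2, R)) : R :=
  2 - (⁅A, g⁆ : SL(2, R)).1.trace

theorem coe_inv_eq_trace_smul_one_sub {R : Type*} [CommRing R] (A : SL(2, R)) :
    (A⁻¹).1 = A.1.trace • 1 - A.1 := by
  rw [Matrix.SpecialLinearGroup.SL2_inv_expl]
  ext i j
  fin_cases i <;> fin_cases j <;> simp [Matrix.trace_fin_two]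

theorem trace_conj_eq {R n : Type*} [CommRing R] [Fintype n] [DecidableEq n]
    (g A : Matrix.SpecialLinearGroup n R) : (g * A * g⁻¹).1.trace = A.1.trace := by
  rw [Matrix.SpecialLinearGroup.coe_mul, Matrix.trace_mul_comm, ← Matrix.SpecialLinearGroup.coe_mul,
    ← mul_assoc, inv_mul_cancel, one_mul]

theorem trace_commutator {R : Type*} [CommRing R] (A B : SL(2, R)) :
    (⁅A, B⁆ : SL(2, R)).1.trace = A.1.trace ^ 2 + B.1.trace ^ 2 + (A * B).1.trace ^ 2 -
      A.1.trace * B.1.trace * (A * B).1.trace - 2 := by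
  have hA := A.2
  have hB := B.2
  rw [Matrix.det_fin_two] at hA hB
  simp only [commutatorElement_def, Matrix.SpecialLinearGroup.coe_mul,
    coe_inv_eq_trace_smul_one_sub, Matrix.trace_fin_two, Matrix.mul_apply, Fin.sum_univ_two,
    Matrix.sub_apply, Matrix.smul_apply, smul_eq_mul, Matrix.one_apply_eq, ne_eq, zero_ne_one,
    one_ne_zero, not_false_eq_true, Matrix.one_apply_ne]
  linear_combination ((B 0 0 + B 1 1) ^ 2 - 2) * hA +
    ((A 0 0 + A 1 1) ^ 2 - 2 * (A 0 0 * A 1 1 - A 0 1 * A 1 0)) * hB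

theorem trace_commutator_eq_sub {R : Type*} [CommRing R] (A g : SL(2, R)) :
    (⁅A, g⁆ : SL(2, R)).1.trace = A.1.trace ^ 2 - (A * (g * A * g⁻¹)).1.trace := by
  have hmat : (⁅A, g⁆ : SL(2, R)).1 = A.1.trace • A.1 - (A * (g * A * g⁻¹)).1 := by
    have hg : g.1 * (g⁻¹).1 = 1 := by rw [← Matrix.SpecialLinearGroup.coe_mul, mul_inv_cancel]; rfl
    simp only [commutatorElement_def, Matrix.SpecialLinearGroup.coe_mul,
      coe_inv_eq_trace_smul_one_sub A, mul_sub, sub_mul, mul_smul_comm, smul_mul_assoc, one_mul,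
      mul_assoc, hg, mul_one]
  rw [hmat, Matrix.trace_sub, Matrix.trace_smul, smul_eq_mul, sq]

theorem commDefect_conj {R : Type*} [CommRing R] (A g : SL(2, R)) :
    commDefect A (g * A * g⁻¹) = -commDefect A g * (A.1.discr + commDefect A g) := by
  rw [commDefect, commDefect, trace_commutator_eq_sub A g, trace_commutator, trace_conj_eq,
    Matrix.discr_fin_two, A.2]
  ring

theorem eq_or_eq_inv_of_commute_conj {K : Type*} [Field K] [NeZero (2 : K)] {A g : SL(2, K)}
    (hA : A.1.discr ≠ 0) (h : Commute A (g * A * g⁻¹)) :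
    g * A * g⁻¹ = A ∨ g * A * g⁻¹ = A⁻¹ :=
  (eq_or_eq_adjugate_of_commute hA (commute_coe_specialLinearGroup_iff.2 h.symm) (trace_conj_eq g A)
    (by rw [A.2, (g * A * g⁻¹).2])).imp (fun heq ↦ Subtype.ext heq) fun heq ↦ Subtype.ext heq

theorem commute_of_commute_conj {K : Type*} [Field K] [NeZero (2 : K)] {A g : SL(2, K)}
    (hA : A.1.discr ≠ 0) (hg : g.1.trace ≠ 0) (h : Commute A (g * A * g⁻¹)) : Commute A g := by
  rcases eq_or_eq_inv_of_commute_conj hA h with heq | heq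
  · exact (mul_inv_eq_iff_eq_mul.1 heq).symm
  · have hmul : g * A = A⁻¹ * g := mul_inv_eq_iff_eq_mul.1 heq
    have hmul' : g.1 * A.1 = A.1.adjugate * g.1 := congrArg Subtype.val hmul
    exact absurd (trace_eq_zero_of_mul_eq_adjugate_mul
      (notMem_range_scalar_of_discr_ne_zero hA) hmul') hg

theorem exists_nonneg_of_recurrence {w : ℕ → ℝ} {D ε : ℝ} (hD : 0 < D) (hD' : D ≤ 1 / 2)
    (hε : ε ≤ 1 / 2) (hw0 : |w 0| < ε) (hw : ∀ k, w (k + 1) = -w k * (D + w k)) :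
    ∃ k, 0 ≤ w k ∧ w k < ε := by
  by_contra! hge
  have hε0 : 0 < ε := (abs_nonneg _).trans_lt hw0
  have hneg (k : ℕ) : w k < 0 ∧ -w k < ε * (1 / 2) ^ k := by
    induction k with
    | zero =>
      rw [abs_lt] at hw0
      exact ⟨lt_of_not_ge fun h ↦ (hge 0 h).not_gt hw0.2, by linarith⟩
    | succ k ih =>
      obtain ⟨hk, hkε⟩ := ih
      have hpow : ε * (1 / 2) ^ k ≤ ε :=
        mul_le_of_le_one_right hε0.le (pow_le_one₀ (by norm_num) (by norm_num))
      have habs : |w (k + 1)| < ε * (1 / 2) ^ (k + 1) := by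
        rw [hw, abs_mul, abs_neg, abs_of_neg hk, pow_succ, ← mul_assoc]
        have : |D + w k| ≤ 1 / 2 := abs_le.2 ⟨by linarith, by linarith⟩
        nlinarith
      have hpow' : ε * (1 / 2) ^ (k + 1) ≤ ε :=
        mul_le_of_le_one_right hε0.le (pow_le_one₀ (by norm_num) (by norm_num))
      rw [abs_lt] at habs
      exact ⟨lt_of_not_ge fun h ↦ (hge (k + 1) h).not_gt (by linarith), by linarith⟩
  obtain ⟨k, hk⟩ := exists_pow_lt_of_lt_one (div_pos hD hε0) (by norm_num : (1 / 2 : ℝ) < 1)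
  rw [lt_div_iff₀ hε0, mul_comm] at hk
  have hnext := (hneg (k + 1)).1
  rw [hw] at hnext
  nlinarith [hneg k]

variable {P : Subgroup SL(2, ℝ)}

theorem commute_of_abs_commDefect_lt {ε : ℝ} (hε : ε ≤ 1 / 2)
    (hgap : ∀ g ∈ P, 2 - ε < g.1.trace → g.1.trace ≤ 2 → g = 1) {A B : SL(2, ℝ)} (hA : A ∈ P)
    (hB : B ∈ P) (hD : A.1.IsHyperbolic) (hD' : A.1.discr ≤ 1 / 2) (htr : B.1.trace ≠ 0)
    (hAB : |commDefect A B| < ε) : Commute A B := by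
  set C : ℕ → SL(2, ℝ) := fun k ↦ (fun g ↦ g * A * g⁻¹)^[k] B
  have hC (k : ℕ) : C (k + 1) = C k * A * (C k)⁻¹ := Function.iterate_succ_apply' _ k B
  have hCP (k : ℕ) : C k ∈ P := by
    induction k with
    | zero => exact hB
    | succ k ih => exact hC k ▸ P.mul_mem (P.mul_mem ih hA) (P.inv_mem ih)
  have hCtr (k : ℕ) : (C k).1.trace ≠ 0 := by
    cases k with
    | zero => exact htr
    | succ k => exact hC k ▸ (trace_conj_eq (C k) A).trans_ne (trace_ne_zero_of_isHyperbolic hD)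
  have hcomm (k : ℕ) (hk : Commute A (C k)) : Commute A B := by
    induction k with
    | zero => exact hk
    | succ k ih => exact ih (commute_of_commute_conj hD.ne' (hCtr k) (hC k ▸ hk))
  obtain ⟨k, hk, hkε⟩ := exists_nonneg_of_recurrence (w := fun k ↦ commDefect A (C k)) hD hD' hε
    hAB fun k ↦ by rw [hC, commDefect_conj, neg_mul]
  refine hcomm k (commutatorElement_eq_one_iff_commute.1 (hgap _ ?_ ?_ ?_))
  · rw [commutatorElement_def]
    exact P.mul_mem (P.mul_mem (P.mul_mem hA (hCP k)) (P.inv_mem hA)) (P.inv_mem (hCP k))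
  · rw [commDefect] at hkε
    linarith
  · rw [commDefect] at hk
    linarith

variable {m : ℕ}

theorem exists_trace_gap_of_forall_isHyperbolic (hm : 0 < m)
    (hP : ∀ g ∈ P, g ^ m = 1 ∨ g.1.IsHyperbolic) :
    ∃ ε > 0, ε ≤ 1 / 2 ∧ ∀ g ∈ P, 2 - ε < g.1.trace → g.1.trace ≤ 2 → g = 1 := by
  obtain ⟨ε, hε, hgap⟩ := exists_trace_gap_of_pow_eq_one hm
  refine ⟨min ε (1 / 2), by positivity, min_le_right _ _, fun g hg hlt hle ↦ ?_⟩
  have hε₁ := min_le_left ε (1 / 2)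
  have hε₂ := min_le_right ε (1 / 2)
  rcases hP g hg with hgm | hhyp
  · exact hgap g hgm (abs_lt.2 ⟨by linarith, by linarith⟩)
  · rw [Matrix.IsHyperbolic, Matrix.discr_fin_two, g.2] at hhyp
    nlinarith

theorem eventually_isHyperbolic (hm : 0 < m) (hP : ∀ g ∈ P, g ^ m = 1 ∨ g.1.IsHyperbolic) :
    ∀ᶠ A in 𝓝 (1 : SL(2, ℝ)), A ∈ P → A ≠ 1 → A.1.IsHyperbolic := by
  obtain ⟨ε, hε, hgap⟩ := exists_trace_gap_of_pow_eq_one hm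
  have hcont : Continuous fun A : SL(2, ℝ) ↦ |A.1.trace - 2| := by fun_prop
  filter_upwards [hcont.continuousAt.eventually_lt_const (show |_| < ε by simpa)] with A hA hAP hne
  exact (hP A hAP).resolve_left fun hAm ↦ hne (hgap A hAm hA)

theorem commute_of_not_discreteTopology (hm : 0 < m)
    (hP : ∀ g ∈ P, g ^ m = 1 ∨ g.1.IsHyperbolic) (hnd : ¬ DiscreteTopology P) {g h : SL(2, ℝ)}
    (hg : g ∈ P) (hghyp : g.1.IsHyperbolic) (hh : h ∈ P) (hhhyp : h.1.IsHyperbolic) :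
    Commute g h := by
  obtain ⟨ε, hε, hε', hgap⟩ := exists_trace_gap_of_forall_isHyperbolic hm hP
  have hdefect (k : SL(2, ℝ)) : ∀ᶠ A in 𝓝 (1 : SL(2, ℝ)), |commDefect A k| < ε := by
    have hcont : Continuous fun A : SL(2, ℝ) ↦ |commDefect A k| := by
      simp only [commDefect, commutatorElement_def]
      fun_prop
    refine hcont.continuousAt.eventually_lt_const ?_
    simpa [commDefect] using hε
  have hdiscr : ∀ᶠ A in 𝓝 (1 : SL(2, ℝ)), A.1.discr < 1 / 2 := by
    simp only [Matrix.discr_fin_two, Matrix.SpecialLinearGroup.det_coe]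
    have hcont : Continuous fun A : SL(2, ℝ) ↦ A.1.trace ^ 2 - 4 * 1 := by fun_prop
    refine hcont.continuousAt.eventually_lt_const ?_
    norm_num
  rw [discreteTopology_subgroup_iff] at hnd
  obtain ⟨A, hA, hAhyp, hAdiscr, hAg, hAh⟩ := (Filter.not_eventually.1 hnd).and_eventually
    ((eventually_isHyperbolic hm hP).and (hdiscr.and ((hdefect g).and (hdefect h)))) |>.exists
  obtain ⟨hAP, hA1⟩ := Classical.not_imp.1 hA
  have hAhyp := hAhyp hAP hA1
  have hcomm {k : SL(2, ℝ)} (hk : k ∈ P) (hkhyp : k.1.IsHyperbolic) (hAk : |commDefect A k| < ε) :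
      Commute k.1 A.1 :=
    commute_coe_specialLinearGroup_iff.2 (commute_of_abs_commDefect_lt hε' hgap hAP hk hAhyp
      hAdiscr.le (trace_ne_zero_of_isHyperbolic hkhyp) hAk).symm
  exact commute_coe_specialLinearGroup_iff.1 (commute_of_commute_of_notMem_range_scalar
    (notMem_range_scalar_of_discr_ne_zero hAhyp.ne') (hcomm hg hghyp hAg) (hcomm hh hhhyp hAh))

end Jorgensen

/-! ### Discreteness -/

section Discreteness

variable {Γ : Type*} [Group Γ] {π σ : Γ →* SL(2, ℝ)} [DiscreteTopology π.range]
  [CompactSpace (SL(2, ℝ) ⧸ π.range)]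

theorem exists_pow_eq_one_or_isHyperbolic
    (hσ : ∀ γ, σ γ ∈ Subgroup.center SL(2, ℝ) ↔ π γ ∈ Subgroup.center SL(2, ℝ))
    (hhyp : ∀ γ, (∀ n : ℕ, 0 < n → π γ ^ n ∉ Subgroup.center SL(2, ℝ)) →
      (σ γ).1.IsHyperbolic) :
    ∃ m : ℕ, 0 < m ∧ ∀ g ∈ σ.range, g ^ m = 1 ∨ g.1.IsHyperbolic := by
  obtain ⟨m, hm, hpow⟩ := exists_pow_eq_one_of_cocompact π.range
  refine ⟨m * 2, by positivity, ?_⟩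
  rintro _ ⟨γ, rfl⟩
  refine or_iff_not_imp_right.2 fun hγ ↦ ?_
  obtain ⟨n, hn, hcenter⟩ : ∃ n : ℕ, 0 < n ∧ π γ ^ n ∈ Subgroup.center SL(2, ℝ) := by
    contrapose! hγ
    exact hhyp γ hγ
  have hfin : IsOfFinOrder (π γ) := (isOfFinOrder_pow.1 <| isOfFinOrder_iff_pow_eq_one.2
    ⟨2, two_pos, pow_card_eq_one_of_mem_center hcenter⟩).resolve_right hn.ne'
  have hmem : σ (γ ^ m) ∈ Subgroup.center SL(2, ℝ) := by
    rw [hσ, map_pow, hpow _ ⟨γ, rfl⟩ hfin]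
    exact one_mem _
  rw [pow_mul, ← map_pow]
  exact pow_card_eq_one_of_mem_center hmem

theorem discreteTopology_range_of_isHyperbolic
    (hσ : ∀ γ, σ γ ∈ Subgroup.center SL(2, ℝ) ↔ π γ ∈ Subgroup.center SL(2, ℝ))
    (hhyp : ∀ γ, (∀ n : ℕ, 0 < n → π γ ^ n ∉ Subgroup.center SL(2, ℝ)) →
      (σ γ).1.IsHyperbolic) : DiscreteTopology σ.range := by
  by_contra hnd
  obtain ⟨m, hm, hrange⟩ := exists_pow_eq_one_or_isHyperbolic hσ hhyp
  obtain ⟨α, hα⟩ : ∃ α, (σ α).1.IsHyperbolic := by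
    obtain ⟨A, hA, hAhyp⟩ := ((Filter.not_eventually.1 (discreteTopology_subgroup_iff.not.1 hnd)
      ).and_eventually (eventually_isHyperbolic hm hrange)).exists
    obtain ⟨⟨α, rfl⟩, hne⟩ := Classical.not_imp.1 hA
    exact ⟨α, hAhyp ⟨α, rfl⟩ hne⟩
  have hconj (γ : Γ) : σ (γ * α * γ⁻¹) = σ α ∨ σ (γ * α * γ⁻¹) = σ α⁻¹ := by
    simp only [map_mul, map_inv]
    refine eq_or_eq_inv_of_commute_conj hα.ne' ?_
    have hmem : σ γ * σ α * (σ γ)⁻¹ ∈ σ.range := ⟨γ * α * γ⁻¹, by simp⟩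
    refine commute_of_not_discreteTopology hm hrange hnd ⟨α, rfl⟩ hα hmem ?_
    rw [Matrix.IsHyperbolic, Matrix.discr_fin_two, trace_conj_eq, (σ γ * σ α * (σ γ)⁻¹).2]
    rwa [Matrix.IsHyperbolic, Matrix.discr_fin_two, (σ α).2] at hα
  have hmul {β β' : Γ} (h : σ β = σ β') :
      π β ∈ (Subgroup.center SL(2, ℝ) : Set SL(2, ℝ)) * {π β'} := by
    refine ⟨π (β * β'⁻¹), ?_, π β', rfl, by simp⟩
    rw [SetLike.mem_coe, ← hσ, map_mul, h, ← map_mul, mul_inv_cancel, map_one]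
    exact one_mem _
  have hfin : {b | ∃ g ∈ π.range, g * π α * g⁻¹ = b}.Finite := by
    have hZ := finite_center_specialLinearGroup (n := Fin 2) (R := ℝ)
    refine ((hZ.mul (Set.finite_singleton (π α))).union
      (hZ.mul (Set.finite_singleton (π α⁻¹)))).subset ?_
    rintro _ ⟨_, ⟨γ, rfl⟩, rfl⟩
    rw [← map_mul, ← map_inv, ← map_mul]
    exact (hconj γ).imp hmul hmul
  have hcenter := (hσ α).2 (mem_center_of_finite_conj_of_cocompact π.range hfin)
  exact notMem_range_scalar_of_discr_ne_zero hα.ne' (coe_mem_range_scalar_iff_mem_center.2 hcenter)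

end Discreteness

/-! ### Lattices of the universal covering group -/

section CentralExtension

/-- The commutator with `δ` is well defined modulo the kernel, so that it is close to `1` at lifts
of elements close to `1`, however large these lifts are. -/
theorem eventually_commute_of_isOpenMap {G G' : Type*} [Group G] [TopologicalSpace G]
    [IsTopologicalGroup G] [Group G'] [TopologicalSpace G'] {f : G →* G'} (hf : IsOpenMap f)
    (hker : f.ker ≤ Subgroup.center G) {Γ : Subgroup G} [DiscreteTopology Γ] {δ : G} (hδ : δ ∈ Γ) :
    ∀ᶠ h in 𝓝 (1 : G'), ∀ γ ∈ Γ, f γ = h → Commute γ δ := by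
  have hcomm : ∀ᶠ u in 𝓝 (1 : G), ⁅u, δ⁆ ∈ Γ → ⁅u, δ⁆ = 1 := by
    have hcont : Continuous fun u : G ↦ ⁅u, δ⁆ := by
      simp only [commutatorElement_def]
      fun_prop
    have hlim := hcont.tendsto 1
    rw [commutatorElement_one_left] at hlim
    exact hlim.eventually (discreteTopology_subgroup_iff.1 ‹_›)
  have himage := hf.image_mem_nhds hcomm
  rw [map_one] at himage
  filter_upwards [himage]
  rintro _ ⟨u, hu, rfl⟩ γ hγ hγu
  have hz : u⁻¹ * γ ∈ Subgroup.center G := hker (f.eq_iff.1 hγu)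
  have heq : ⁅γ, δ⁆ = ⁅u, δ⁆ := by
    have hγ_eq : γ = u * (u⁻¹ * γ) := (mul_inv_cancel_left _ _).symm
    rw [hγ_eq, commutatorElement_def, commutatorElement_def, mul_assoc u,
      ← Subgroup.mem_center_iff.1 hz δ]
    group
  have hmem : ⁅u, δ⁆ ∈ Γ := by
    rw [← heq, commutatorElement_def]
    exact mul_mem (mul_mem (mul_mem hγ hδ) (inv_mem hγ)) (inv_mem hδ)
  exact commutatorElement_eq_one_iff_commute.1 (heq.trans (hu hmem))

theorem discreteTopology_map_of_isOpenMap {G : Type*} [Group G] [TopologicalSpace G]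
    [IsTopologicalGroup G] {f : G →* SL(2, ℝ)} (hf : IsOpenMap f)
    (hker : f.ker ≤ Subgroup.center G) (Γ : Subgroup G) [DiscreteTopology Γ]
    [CompactSpace (SL(2, ℝ) ⧸ Γ.map f)] : DiscreteTopology (Γ.map f) := by
  by_cases hcentral : Γ.map f ≤ Subgroup.center SL(2, ℝ)
  · have : Finite (Γ.map f) := finite_center_specialLinearGroup.subset hcentral
    infer_instance
  obtain ⟨_, ⟨δ, hδ, rfl⟩, hδ_center⟩ := SetLike.not_le_iff_exists.1 hcentral
  obtain ⟨_, ⟨δ', hδ', rfl⟩, hδδ'⟩ : ∃ b ∈ Γ.map f, ¬ Commute b (f δ) := by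
    contrapose! hδ_center
    exact mem_center_of_forall_commute_of_cocompact (Γ.map f) hδ_center
  have hZ : DiscreteTopology (Subgroup.center SL(2, ℝ)) :=
    haveI : Finite (Subgroup.center SL(2, ℝ)) := finite_center_specialLinearGroup
    inferInstance
  refine discreteTopology_subgroup_iff.2 ?_
  filter_upwards [eventually_commute_of_isOpenMap hf hker hδ,
    eventually_commute_of_isOpenMap hf hker hδ',
    discreteTopology_subgroup_iff.1 hZ]
  rintro _ hcomm hcomm' hone ⟨γ, hγ, rfl⟩
  refine hone (coe_mem_range_scalar_iff_mem_center.1 ?_)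
  by_contra hscalar
  exact hδδ' <| commute_coe_specialLinearGroup_iff.1 <|
    commute_of_commute_of_notMem_range_scalar hscalar
      (commute_coe_specialLinearGroup_iff.2 ((hcomm' γ hγ rfl).map f).symm)
      (commute_coe_specialLinearGroup_iff.2 ((hcomm γ hγ rfl).map f).symm)

end CentralExtension

namespace SLTilde

/-- The covering map. -/
def proj : SLTilde →* SL(2, ℝ) where
  toFun p := p.1.1
  map_one' := rfl
  map_mul' _ _ := rfl

theorem continuous_proj : Continuous proj := continuous_subtype_val.fst

theorem denom_apply (g : SL(2, ℝ)) (z : ℍ) :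
    denom (g : GL (Fin 2) ℝ) z = (g.1 1 0 : ℂ) * z + g.1 1 1 := rfl

/-- The matrices whose automorphy factors have values in the domain of the principal branch of the
logarithm. -/
def logDomain : Set SL(2, ℝ) := {g | g.1 1 0 ≠ 0 ∨ 0 < g.1 1 1}

theorem isOpen_logDomain : IsOpen logDomain :=
  (isOpen_ne_fun (f := fun g : SL(2, ℝ) ↦ g.1 1 0) (by fun_prop) continuous_const).union
    (isOpen_lt (g := fun g : SL(2, ℝ) ↦ g.1 1 1) continuous_const (by fun_prop))

theorem denom_mem_slitPlane {g : SL(2, ℝ)} (hg : g ∈ logDomain) (z : ℍ) :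
    denom (g : GL (Fin 2) ℝ) z ∈ Complex.slitPlane := by
  rw [denom_apply, Complex.mem_slitPlane_iff]
  by_cases hc : g.1 1 0 = 0
  · exact .inl (by simpa [hc] using hg.resolve_left (not_not.2 hc))
  · exact .inr (by simpa [hc] using z.im_ne_zero)

theorem continuous_denom : Continuous fun p : SL(2, ℝ) × ℍ ↦ denom (p.1 : GL (Fin 2) ℝ) p.2 := by
  simp only [denom_apply]
  fun_prop

/-- The section of `proj` given by the principal branch of the logarithm. -/
noncomputable def logLift (g : logDomain) : SLTilde :=
  ⟨(g.1, ⟨fun z ↦ Complex.log (denom (g.1 : GL (Fin 2) ℝ) z),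
    (continuous_denom.comp (.prodMk_right g.1)).clog (denom_mem_slitPlane g.2)⟩),
    fun z ↦ Complex.exp_log (Complex.slitPlane_ne_zero (denom_mem_slitPlane g.2 z))⟩

theorem continuous_logLift : Continuous logLift := by
  refine Continuous.subtype_mk (continuous_subtype_val.prodMk ?_) _
  refine ContinuousMap.continuous_of_continuous_uncurry _ ?_
  exact (continuous_denom.comp (continuous_subtype_val.prodMap continuous_id)).clog
    fun p ↦ denom_mem_slitPlane p.1.2 p.2

theorem one_mem_logDomain : 1 ∈ logDomain := by simp [logDomain]

theorem logLift_one : logLift ⟨1, one_mem_logDomain⟩ = 1 :=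
  ext' rfl fun z ↦ by
    change Complex.log (denom ((1 : SL(2, ℝ)) : GL (Fin 2) ℝ) z) = 0
    simp

theorem isOpenMap_proj : IsOpenMap proj := by
  refine IsTopologicalGroup.isOpenMap_iff_nhds_one.2 ?_
  calc 𝓝 (1 : SL(2, ℝ)) = map (proj ∘ logLift) (𝓝 ⟨1, one_mem_logDomain⟩) :=
        (isOpen_logDomain.isOpenEmbedding_subtypeVal.map_nhds_eq ⟨1, one_mem_logDomain⟩).symm
    _ = map proj (map logLift (𝓝 ⟨1, one_mem_logDomain⟩)) := map_map.symm
    _ ≤ map proj (𝓝 1) := map_mono (logLift_one ▸ continuous_logLift.tendsto _)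

/-- The lift of `-1` with angle `π`. -/
noncomputable def negOneLift : SLTilde :=
  ⟨(-1, .const _ (Real.pi * Complex.I)), fun z ↦ by simp [denom_apply]⟩

theorem proj_surjective : Function.Surjective proj := by
  intro g
  by_cases hg : g ∈ logDomain
  · exact ⟨logLift ⟨g, hg⟩, rfl⟩
  obtain ⟨hc, hd⟩ : g.1 1 0 = 0 ∧ g.1 1 1 ≤ 0 := by simpa [logDomain] using hg
  have hd_ne : g.1 1 1 ≠ 0 := fun hd0 ↦ by
    have hdet : g.1.det = 1 := g.2
    rw [Matrix.det_fin_two, hc, hd0, mul_zero, mul_zero, sub_zero] at hdet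
    exact zero_ne_one hdet
  have hneg : -g ∈ logDomain := .inr (by simpa using hd.lt_of_ne hd_ne)
  exact ⟨negOneLift * logLift ⟨-g, hneg⟩, (neg_mul_neg 1 g).trans (one_mul g)⟩

theorem mem_center_of_proj_mem_center {p : SLTilde}
    (hp : proj p ∈ Subgroup.center SL(2, ℝ)) : p ∈ Subgroup.center SLTilde := by
  obtain ⟨r, -, hrp⟩ := Matrix.SpecialLinearGroup.mem_center_iff.1 hp
  have hr : r ≠ 0 := by
    rintro rfl
    simpa [← hrp] using (proj p).2
  have hdenom (z : ℍ) : denom (p.1.1 : GL (Fin 2) ℝ) z = r := by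
    rw [denom_apply, ← show _ = p.1.1.1 from hrp]
    simp
  have hsmul (z : ℍ) : p.1.1 • z = z := by
    ext
    rw [UpperHalfPlane.coe_specialLinearGroup_apply, ← show _ = p.1.1.1 from hrp]
    simp [hr]
  have hconst (z w : ℍ) : p.1.2 z = p.1.2 w :=
    Complex.isCoveringMap_exp.const_of_comp p.1.2.continuous
      (fun z w ↦ Subtype.ext (by simp only [p.2, hdenom])) z w
  refine Subgroup.mem_center_iff.2 fun q ↦ ext' (Subgroup.mem_center_iff.1 hp q.1.1) fun z ↦ ?_
  rw [mul_snd, mul_snd, hsmul, hconst (q.1.1 • z) z, add_comm]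

theorem mem_center_iff (Γ : Subgroup SLTilde) [CompactSpace (SLTilde ⧸ Γ)] (γ : Γ) :
    γ ∈ Subgroup.center Γ ↔ proj γ ∈ Subgroup.center SL(2, ℝ) := by
  have := compactSpace_quotient_map Γ continuous_proj proj_surjective
  refine ⟨fun h ↦ mem_center_of_forall_commute_of_cocompact (Γ.map proj) ?_, fun h ↦
    Subgroup.mem_center_iff.2 fun δ ↦ Subtype.ext
      (Subgroup.mem_center_iff.1 (mem_center_of_proj_mem_center h) δ)⟩
  rintro _ ⟨δ, hδ, rfl⟩
  exact Commute.map (congrArg Subtype.val (Subgroup.mem_center_iff.1 h ⟨δ, hδ⟩)) proj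

end SLTilde

/-! ### Spectral radius and stable norm -/

section SpectralRadius

theorem spectralRadius_pow_le_pow {𝕜 A : Type*} [NormedField 𝕜] [IsAlgClosed 𝕜] [Ring A]
    [Algebra 𝕜 A] (a : A) {n : ℕ} (hn : 0 < n) :
    spectralRadius 𝕜 (a ^ n) ≤ spectralRadius 𝕜 a ^ n := by
  refine iSup₂_le fun k hk ↦ ?_
  rw [spectrum.map_pow_of_pos _ hn] at hk
  obtain ⟨μ, hμ, rfl⟩ := hk
  simp only [nnnorm_pow, ENNReal.coe_pow]
  gcongr
  exact le_iSup₂ (f := fun (k : 𝕜) (_ : k ∈ spectrum 𝕜 a) ↦ (‖k‖₊ : ℝ≥0∞)) μ hμ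

theorem nnnorm_det_le_spectralRadius_pow {𝕜 n : Type*} [NormedField 𝕜] [IsAlgClosed 𝕜] [Fintype n]
    [DecidableEq n] (A : Matrix n n 𝕜) :
    (‖A.det‖₊ : ℝ≥0∞) ≤ spectralRadius 𝕜 A ^ Fintype.card n := by
  have hcard : A.charpoly.roots.card = Fintype.card n := by
    rw [(IsAlgClosed.splits A.charpoly).natDegree_eq_card_roots.symm, A.charpoly_natDegree_eq_dim]
  rw [A.det_eq_prod_roots_charpoly, ← hcard, ← Multiset.card_map fun μ ↦ (‖μ‖₊ : ℝ≥0∞)]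
  calc (‖A.charpoly.roots.prod‖₊ : ℝ≥0∞)
      = (A.charpoly.roots.map fun μ ↦ (‖μ‖₊ : ℝ≥0∞)).prod :=
        map_multiset_prod (ENNReal.ofNNRealHom.toMonoidHom.comp nnnormHom.toMonoidHom) _
    _ ≤ _ := by
      refine Multiset.prod_le_pow_card _ _ fun x hx ↦ ?_
      obtain ⟨μ, hμ, rfl⟩ := Multiset.mem_map.1 hx
      exact le_iSup₂ (f := fun (k : 𝕜) (_ : k ∈ spectrum 𝕜 A) ↦ (‖k‖₊ : ℝ≥0∞)) μ
        (Matrix.mem_spectrum_of_isRoot_charpoly (Polynomial.isRoot_of_mem_roots hμ))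

theorem spectralRadius_map_le_nnnorm {n : Type*} [Fintype n] [DecidableEq n] [Nonempty n]
    (A : Matrix n n ℝ) : spectralRadius ℂ (A.map (algebraMap ℝ ℂ)) ≤ ‖A‖₊ := by
  refine (spectrum.spectralRadius_le_nnnorm _).trans_eq ?_
  simp [Matrix.linfty_opNNNorm_def]

end SpectralRadius

section StableNorm

theorem GL0.det_pos (g : GL0) : 0 < g.1.1.det := g.2

/-- The unimodular part `g / √(det g)` of a matrix of positive determinant. -/
noncomputable def unimodularPart : GL0 →* SL(2, ℝ) where
  toFun g := ⟨(√g.1.1.det)⁻¹ • g.1.1, by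
    rw [Matrix.det_smul, Fintype.card_fin, inv_pow, Real.sq_sqrt (GL0.det_pos g).le,
      inv_mul_cancel₀ (GL0.det_pos g).ne']⟩
  map_one' := Subtype.ext (by simp)
  map_mul' g h := Subtype.ext (by
    change (√(g.1.1 * h.1.1).det)⁻¹ • (g.1.1 * h.1.1) =
      ((√g.1.1.det)⁻¹ • g.1.1) * ((√h.1.1.det)⁻¹ • h.1.1)
    rw [Matrix.det_mul, Real.sqrt_mul (GL0.det_pos g).le, mul_inv, smul_mul_smul_comm])

theorem sqrt_det_pos (g : GL0) : 0 < √g.1.1.det := Real.sqrt_pos.2 (GL0.det_pos g)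

theorem coe_unimodularPart (g : GL0) : (unimodularPart g).1 = (√g.1.1.det)⁻¹ • g.1.1 := rfl

theorem sqrt_det_smul_unimodularPart (g : GL0) : √g.1.1.det • (unimodularPart g).1 = g.1.1 :=
  smul_inv_smul₀ (sqrt_det_pos g).ne' _

theorem norm_unimodularPart (g : GL0) : ‖(unimodularPart g).1‖ = ‖g.1.1‖ / √g.1.1.det := by
  rw [coe_unimodularPart, norm_smul, Real.norm_of_nonneg (inv_nonneg.2 (sqrt_det_pos g).le),
    inv_mul_eq_div]

theorem eq_of_unimodularPart_eq {g h : GL0} (hdet : g.1.1.det = h.1.1.det)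
    (hgh : unimodularPart g = unimodularPart h) : g = h :=
  Subtype.ext <| Units.ext <| by
    rw [← sqrt_det_smul_unimodularPart g, ← sqrt_det_smul_unimodularPart h, hdet, hgh]

theorem unimodularPart_mem_center_iff {g : GL0} :
    unimodularPart g ∈ Subgroup.center SL(2, ℝ) ↔ g ∈ Subgroup.center GL0 := by
  refine ⟨fun hg ↦ Subgroup.mem_center_iff.2 fun h ↦ ?_, fun hg ↦
    Subgroup.mem_center_iff.2 fun h ↦ ?_⟩
  · refine eq_of_unimodularPart_eq ?_ ?_
    · exact (Matrix.det_mul _ _).trans ((mul_comm _ _).trans (Matrix.det_mul _ _).symm)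
    · rw [map_mul, map_mul, Subgroup.mem_center_iff.1 hg]
  · have hcomm : h.1 * g.1.1 = g.1.1 * h.1 := congrArg (fun k : GL0 ↦ k.1.1)
      (Subgroup.mem_center_iff.1 hg (Matrix.SpecialLinearGroup.toGLPos h))
    exact Subtype.ext (show h.1 * _ = _ * h.1 by
      rw [coe_unimodularPart, mul_smul_comm, smul_mul_assoc, hcomm])

theorem one_le_spectralRadius_div_sqrt_det (g : GL0) :
    1 ≤ (spectralRadius ℂ (g.1.1.map (algebraMap ℝ ℂ))).toReal / √g.1.1.det := by
  rw [one_le_div (sqrt_det_pos g)]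
  refine Real.sqrt_le_iff.2 ⟨ENNReal.toReal_nonneg, ?_⟩
  have hle := nnnorm_det_le_spectralRadius_pow (g.1.1.map (algebraMap ℝ ℂ))
  have hdet : (g.1.1.map (algebraMap ℝ ℂ)).det = (g.1.1.det : ℂ) :=
    ((algebraMap ℝ ℂ).map_det g.1.1).symm
  rw [Fintype.card_fin, hdet] at hle
  have hle' := ENNReal.toReal_mono (ENNReal.pow_ne_top
    (ne_top_of_le_ne_top ENNReal.coe_ne_top (spectralRadius_map_le_nnnorm g.1.1))) hle
  simpa [abs_of_pos (GL0.det_pos g)] using hle'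

variable {G : Type*} [Group G] (ρ : G →* GL0)

theorem geodesicLength_nonneg (γ : G) : 0 ≤ geodesicLength ρ γ :=
  mul_nonneg zero_le_two (Real.log_nonneg (one_le_spectralRadius_div_sqrt_det (ρ γ)))

theorem geodesicLength_le_two_mul_log_norm (γ : G) :
    geodesicLength ρ γ ≤ 2 * Real.log ‖(unimodularPart (ρ γ)).1‖ := by
  have hone := one_le_spectralRadius_div_sqrt_det (ρ γ)
  rw [geodesicLength, norm_unimodularPart]
  gcongr
  exact ENNReal.toReal_mono ENNReal.coe_ne_top (spectralRadius_map_le_nnnorm (ρ γ).1.1)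

theorem geodesicLength_pow_le (γ : G) {n : ℕ} (hn : 0 < n) :
    geodesicLength ρ (γ ^ n) ≤ n * geodesicLength ρ γ := by
  have hone := one_le_spectralRadius_div_sqrt_det (ρ (γ ^ n))
  have hpow : (ρ (γ ^ n)).1.1 = (ρ γ).1.1 ^ n := by
    rw [map_pow]
    rfl
  have hsqrt : √((ρ γ).1.1 ^ n).det = √(ρ γ).1.1.det ^ n := by
    rw [Matrix.det_pow, Real.sqrt_eq_iff_mul_self_eq_of_pos (pow_pos (sqrt_det_pos _) n), ← mul_pow,
      Real.mul_self_sqrt (GL0.det_pos _).le]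
  have hne : spectralRadius ℂ ((ρ γ).1.1.map (algebraMap ℝ ℂ)) ≠ ⊤ :=
    ne_top_of_le_ne_top ENNReal.coe_ne_top (spectralRadius_map_le_nnnorm _)
  rw [hpow] at hone
  rw [geodesicLength, geodesicLength, mul_left_comm, ← Real.log_pow, div_pow, hpow, ← hsqrt]
  gcongr
  rw [← ENNReal.toReal_pow, Matrix.map_pow]
  exact ENNReal.toReal_mono (ENNReal.pow_ne_top hne) (spectralRadius_pow_le_pow _ hn)

theorem homologyClass_pow (γ : G) (n : ℕ) : homologyClass (γ ^ n) = n • homologyClass γ := by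
  rw [homologyClass, homologyClass, ← ofMul_pow, ← map_pow]
  rfl

theorem stableNorm_homologyClass_le (γ : G) :
    stableNorm ρ (homologyClass γ) ≤ geodesicLength ρ γ := by
  have hpos (n : ℕ) : 0 ∈ lowerBounds {s : ℝ | ∃ δ : G,
      homologyClass δ = n • homologyClass γ ∧ s = geodesicLength ρ δ / n} := by
    rintro s ⟨δ, -, rfl⟩
    exact div_nonneg (geodesicLength_nonneg ρ δ) n.cast_nonneg
  refine liminf_le_of_frequently_le (Eventually.frequently ?_)
    (isBoundedUnder_of ⟨0, fun n ↦ Real.sInf_nonneg (hpos n)⟩)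
  filter_upwards [eventually_gt_atTop 0] with n hn
  refine (csInf_le ⟨0, hpos n⟩ ⟨γ ^ n, homologyClass_pow γ n, rfl⟩).trans ?_
  rw [div_le_iff₀ (by exact_mod_cast hn), mul_comm]
  exact geodesicLength_pow_le ρ γ hn

variable {ρ}

theorem abs_logFactor_le (hρ : dualStableNorm ρ ≠ ⊤) (γ : G) :
    |logFactor ρ γ| ≤ (dualStableNorm ρ).toReal * geodesicLength ρ γ := by
  have hle : ENNReal.ofReal |logFactor ρ γ| ≤
      dualStableNorm ρ * ENNReal.ofReal (geodesicLength ρ γ) := by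
    have hdual : ENNReal.ofReal |logFactor ρ γ| / ENNReal.ofReal (stableNorm ρ (homologyClass γ)) ≤
      dualStableNorm ρ := le_iSup (fun γ : G ↦ ENNReal.ofReal |logFactor ρ γ| /
        ENNReal.ofReal (stableNorm ρ (homologyClass γ))) γ
    refine (ENNReal.div_le_iff_le_mul (.inr hρ) (.inl ENNReal.ofReal_ne_top)).1 hdual |>.trans ?_
    gcongr
    exact stableNorm_homologyClass_le ρ γ
  rw [← ENNReal.ofReal_toReal hρ, ← ENNReal.ofReal_mul ENNReal.toReal_nonneg] at hle
  exact (ENNReal.ofReal_le_ofReal_iff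
    (mul_nonneg ENNReal.toReal_nonneg (geodesicLength_nonneg ρ γ))).1 hle

end StableNorm

/-! ### Hyperbolic representations -/

section HyperbolicRep

theorem trace_eq_add_and_det_eq_mul_of_hasEigenvalue {K : Type*} [Field K]
    {A : Matrix (Fin 2) (Fin 2) K} {a b : K} (hab : a ≠ b)
    (ha : Module.End.HasEigenvalue (Matrix.toLin' A) a)
    (hb : Module.End.HasEigenvalue (Matrix.toLin' A) b) : A.trace = a + b ∧ A.det = a * b := by
  simp only [Module.End.hasEigenvalue_iff_isRoot_charpoly, Matrix.charpoly_toLin',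
    Polynomial.IsRoot, Matrix.charpoly_fin_two, Polynomial.eval_add, Polynomial.eval_sub,
    Polynomial.eval_mul, Polynomial.eval_pow, Polynomial.eval_X, Polynomial.eval_C] at ha hb
  have htr : A.trace = a + b := mul_left_cancel₀ (sub_ne_zero.2 hab) (by linear_combination hb - ha)
  exact ⟨htr, by linear_combination ha + a * htr⟩

theorem isHyperbolic_unimodularPart_iff {g : GL0} :
    (unimodularPart g).1.IsHyperbolic ↔ g.1.1.IsHyperbolic := by
  have hdiscr : (unimodularPart g).1.discr = (√g.1.1.det)⁻¹ ^ 2 * g.1.1.discr := by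
    rw [Matrix.discr_fin_two, Matrix.discr_fin_two, coe_unimodularPart, Matrix.trace_smul,
      Matrix.det_smul, Fintype.card_fin, smul_eq_mul]
    ring
  rw [Matrix.IsHyperbolic, Matrix.IsHyperbolic, hdiscr,
    mul_pos_iff_of_pos_left (pow_pos (inv_pos.2 (sqrt_det_pos g)) 2)]

variable {G : Type*} [Group G] {ρ : G →* GL0}

theorem det_map_pow (γ : G) (n : ℕ) : (ρ (γ ^ n)).1.1.det = (ρ γ).1.1.det ^ n := by
  rw [map_pow]
  exact Matrix.det_pow _ n

theorem det_eq_one_of_map_mem_center (hρ : dualStableNorm ρ ≠ ⊤) {γ : G}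
    (hγ : ρ γ ∈ Subgroup.center GL0) : (ρ γ).1.1.det = 1 := by
  obtain ⟨a, ha⟩ := coe_mem_range_scalar_iff_mem_center.2 (unimodularPart_mem_center_iff.2 hγ)
  have hsq : |a| = 1 := by
    have hdet := (unimodularPart (ρ γ)).2
    rw [← ha, Matrix.scalar_apply, Matrix.det_diagonal, Finset.prod_const, Finset.card_fin] at hdet
    rwa [← pow_eq_one_iff_of_nonneg (abs_nonneg a) two_ne_zero, sq_abs]
  have hnorm : ‖(unimodularPart (ρ γ)).1‖ = 1 := by
    rw [← ha, Matrix.scalar_apply, ← Matrix.smul_one_eq_diagonal, norm_smul, norm_one, mul_one,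
      Real.norm_eq_abs, hsq]
  have hlen : geodesicLength ρ γ = 0 :=
    ((geodesicLength_le_two_mul_log_norm ρ γ).trans_eq (by simp [hnorm])).antisymm
      (geodesicLength_nonneg ρ γ)
  have hlog := abs_logFactor_le hρ γ
  rw [hlen, mul_zero, abs_nonpos_iff] at hlog
  exact Real.sqrt_eq_one.1 (Real.eq_one_of_pos_of_log_eq_zero (sqrt_det_pos _) hlog)

theorem injective_unimodularPart_comp_subtype (hρ : dualStableNorm ρ ≠ ⊤) :
    Function.Injective (unimodularPart.comp ρ.range.subtype) := by
  rw [injective_iff_map_eq_one]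
  rintro ⟨_, γ, rfl⟩ hγ
  have hγ : unimodularPart (ρ γ) = 1 := hγ
  have hdet := det_eq_one_of_map_mem_center hρ
    (unimodularPart_mem_center_iff.1 (hγ ▸ Subgroup.one_mem _))
  exact Subtype.ext (eq_of_unimodularPart_eq (hdet.trans Matrix.det_one.symm)
    (hγ.trans (map_one _).symm))

namespace IsHyperbolicRep

theorem map_mem_center_iff (hρ : IsHyperbolicRep ρ) {γ : G} :
    ρ γ ∈ Subgroup.center GL0 ↔ γ ∈ Subgroup.center G := by
  rw [← hρ.ker_eq, MonoidHom.mem_ker]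
  exact (QuotientGroup.eq_one_iff _).symm

theorem exists_trace_eq_add_and_det_eq_mul (hρ : IsHyperbolicRep ρ) {γ : G}
    (hγ : ∀ n : ℕ, 0 < n → γ ^ n ∉ Subgroup.center G) :
    ∃ a b : ℝ, 1 < |a| ∧ |b| < 1 ∧ (ρ γ).1.1.trace = a + b ∧ (ρ γ).1.1.det = a * b := by
  obtain ⟨a, b, ha, hb, hEa, hEb⟩ := hρ.saddle γ hγ
  exact ⟨a, b, ha, hb, trace_eq_add_and_det_eq_mul_of_hasEigenvalue
    (fun h ↦ (h ▸ ha).not_gt hb) hEa hEb⟩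

theorem isHyperbolic (hρ : IsHyperbolicRep ρ) {γ : G}
    (hγ : ∀ n : ℕ, 0 < n → γ ^ n ∉ Subgroup.center G) : (ρ γ).1.1.IsHyperbolic := by
  obtain ⟨a, b, ha, hb, htr, hdet⟩ := hρ.exists_trace_eq_add_and_det_eq_mul hγ
  have hab : a ≠ b := fun h ↦ (h ▸ ha).not_gt hb
  rw [Matrix.IsHyperbolic, Matrix.discr_fin_two, htr, hdet,
    show (a + b) ^ 2 - 4 * (a * b) = (a - b) ^ 2 by ring]
  exact sq_pos_of_ne_zero (sub_ne_zero.2 hab)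

theorem trace_ne_one_add_det (hρ : IsHyperbolicRep ρ) {γ : G}
    (hγ : ∀ n : ℕ, 0 < n → γ ^ n ∉ Subgroup.center G) :
    (ρ γ).1.1.trace ≠ 1 + (ρ γ).1.1.det := by
  obtain ⟨a, b, ha, hb, htr, hdet⟩ := hρ.exists_trace_eq_add_and_det_eq_mul hγ
  rw [htr, hdet]
  intro h
  rcases mul_eq_zero.1 (show (1 - a) * (1 - b) = 0 by linear_combination -h) with ha1 | hb1
  · simp [← sub_eq_zero.1 ha1] at ha
  · simp [← sub_eq_zero.1 hb1] at hb

theorem eq_one_of_trace_eq_one_add_det (hρ : IsHyperbolicRep ρ)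
    (hstable : dualStableNorm ρ ≠ ⊤) {γ : G}
    (hγ : (ρ γ).1.1.trace = 1 + (ρ γ).1.1.det) : ρ γ = 1 := by
  obtain ⟨n, hn, hcenter⟩ : ∃ n : ℕ, 0 < n ∧ γ ^ n ∈ Subgroup.center G := by
    by_contra! h
    exact hρ.trace_ne_one_add_det h hγ
  have hcenter := hρ.map_mem_center_iff.2 hcenter
  have hdet : (ρ γ).1.1.det = 1 := by
    rw [← pow_eq_one_iff_of_nonneg (GL0.det_pos _).le hn.ne', ← det_map_pow]
    exact det_eq_one_of_map_mem_center hstable hcenter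
  have hfin : IsOfFinOrder (unimodularPart (ρ γ)) := by
    refine IsOfFinOrder.of_pow (n := n) (isOfFinOrder_iff_pow_eq_one.2
      ⟨2, two_pos, ?_⟩) hn.ne'
    rw [← map_pow, ← map_pow ρ]
    exact pow_card_eq_one_of_mem_center (unimodularPart_mem_center_iff.2 hcenter)
  have htr : (unimodularPart (ρ γ)).1.trace = 2 := by
    rw [coe_unimodularPart, hdet, Real.sqrt_one, inv_one, one_smul, hγ, hdet]
    norm_num
  exact eq_of_unimodularPart_eq (hdet.trans Matrix.det_one.symm)
    ((eq_one_of_isOfFinOrder_of_trace_eq_two hfin htr).trans (map_one _).symm)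

end IsHyperbolicRep

end HyperbolicRep

/-! ### Affine coordinates of flags -/

namespace RP2

/-- The affine chart `(a, b) ↦ [a : b : 1]`. On the dual plane it gives the line
`{(s, t) | a * s + b * t = -1}`, so its range consists of the lines that avoid the origin. -/
noncomputable def affine (x : Fin 2 → ℝ) : RP2 :=
  Projectivization.mk ℝ ![x 0, x 1, 1] fun h ↦ one_ne_zero (congrFun h 2)

theorem mk_eq_affine_iff {v : Fin 3 → ℝ} (hv : v ≠ 0) {x : Fin 2 → ℝ} :
    Projectivization.mk ℝ v hv = affine x ↔ v 2 ≠ 0 ∧ x = ![v 0 / v 2, v 1 / v 2] := by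
  rw [affine, Projectivization.mk_eq_mk_iff']
  constructor
  · rintro ⟨a, rfl⟩
    have ha : a ≠ 0 := fun ha ↦ hv (by simp [ha])
    refine ⟨by simpa using ha, ?_⟩
    ext i
    fin_cases i <;> simp [ha]
  · rintro ⟨hv2, rfl⟩
    refine ⟨v 2, ?_⟩
    ext i
    fin_cases i <;> simp [mul_div_cancel₀, hv2]

theorem affine_injective : Function.Injective affine := fun x y hxy ↦ by
  rw [((mk_eq_affine_iff _).1 hxy).2]
  ext i
  fin_cases i <;> simp

theorem continuous_affine : Continuous affine := by
  have hmk : Continuous (Projectivization.mk' ℝ (V := Fin 3 → ℝ)) := continuous_coinduced_rng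
  refine hmk.comp (Continuous.subtype_mk ?_ _)
  fun_prop

theorem isOpenMap_affine : IsOpenMap affine := fun U hU ↦ by
  rw [isOpen_coinduced]
  have hpre : Projectivization.mk' ℝ ⁻¹' (affine '' U) = {v : {v : Fin 3 → ℝ // v ≠ 0} |
      v.1 2 ≠ 0} ∩ (fun v ↦ ![v.1 0 / v.1 2, v.1 1 / v.1 2]) ⁻¹' U := by
    ext v
    simp only [Set.mem_preimage, Set.mem_image, Projectivization.mk'_eq_mk, eq_comm (a := affine _),
      mk_eq_affine_iff, Set.mem_inter_iff, Set.mem_ofPred_eq]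
    aesop
  rw [hpre]
  have hcoord (i : Fin 3) : Continuous fun v : {v : Fin 3 → ℝ // v ≠ 0} ↦ v.1 i :=
    (continuous_apply i).comp continuous_subtype_val
  refine ContinuousOn.isOpen_inter_preimage ?_ (isOpen_ne_fun (hcoord 2) continuous_const) hU
  refine continuousOn_pi.2 fun i ↦ ?_
  fin_cases i <;> exact (hcoord _).continuousOn.div (hcoord 2).continuousOn fun v hv ↦ hv

theorem isOpenEmbedding_affine : IsOpenEmbedding affine :=
  .of_continuous_injective_isOpenMap continuous_affine affine_injective isOpenMap_affine

theorem orthogonal_affine_iff {x y : Fin 2 → ℝ} :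
    (affine x).orthogonal (affine y) ↔ x ⬝ᵥ y = -1 := by
  rw [affine, affine, Projectivization.orthogonal_mk, eq_neg_iff_add_eq_zero]
  simp [dotProduct, Fin.sum_univ_three]

theorem mem_range_affine_iff {p : RP2} : p ∈ Set.range affine ↔ ¬ p.orthogonal lineAtInfinity := by
  induction p using Projectivization.ind with | h v hv =>
  simp only [Set.mem_range, eq_comm (a := affine _), mk_eq_affine_iff, exists_and_left,
    exists_eq, and_true, lineAtInfinity, Projectivization.orthogonal_mk]
  simp [dotProduct, Fin.sum_univ_three]

theorem toGL3_smul_affine (g : GL0) (x : Fin 2 → ℝ) :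
    toGL3 g • affine x = affine (g.1.1 *ᵥ x) := by
  rw [affine, Projectivization.smul_mk]
  congr 1
  change blockHom g.1.1 *ᵥ _ = _
  ext i
  fin_cases i <;> simp [blockHom, Matrix.mulVec, dotProduct, Fin.sum_univ_succ]

theorem theta_smul_affine (g : GL0) (y : Fin 2 → ℝ) :
    theta (toGL3 g) • affine y = affine (y ᵥ* (g⁻¹).1.1) := by
  rw [affine, Projectivization.smul_mk]
  congr 1
  change (blockHom (g⁻¹).1.1)ᵀ *ᵥ _ = _
  ext i
  fin_cases i <;> simp [blockHom, Matrix.mulVec, Matrix.vecMul, dotProduct, Fin.sum_univ_succ,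
    mul_comm]

end RP2

namespace X0

theorem exists_eq_affine (f : X0) :
    ∃ x y : Fin 2 → ℝ, x ⬝ᵥ y = -1 ∧ f.1 = (RP2.affine x, RP2.affine y) := by
  obtain ⟨⟨p, d⟩, hpd, ⟨hp, -⟩, hd⟩ := f
  obtain ⟨x, rfl⟩ := RP2.mem_range_affine_iff.2 hp
  obtain ⟨y, rfl⟩ := RP2.mem_range_affine_iff.2 fun h ↦ hd (Projectivization.orthogonal_comm.1 h)
  exact ⟨x, y, RP2.orthogonal_affine_iff.1 hpd, rfl⟩

theorem coe_smul_eq_affine (g : GL0) {f : X0} {x y : Fin 2 → ℝ}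
    (hf : f.1 = (RP2.affine x, RP2.affine y)) :
    (g • f).1 = (RP2.affine (g.1.1 *ᵥ x), RP2.affine (y ᵥ* (g⁻¹).1.1)) := by
  change (toGL3 g • f.1.1, theta (toGL3 g) • f.1.2) = _
  rw [hf, RP2.toGL3_smul_affine, RP2.theta_smul_affine]

theorem trace_eq_one_add_det_of_smul_eq {g : GL0} {f : X0} (hf : g • f = f) :
    g.1.1.trace = 1 + g.1.1.det := by
  obtain ⟨x, y, hxy, hfxy⟩ := exists_eq_affine f
  have hx : g.1.1 *ᵥ x = x := RP2.affine_injective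
    (congrArg Prod.fst ((coe_smul_eq_affine g hfxy).symm.trans (hf ▸ hfxy)))
  have hx0 : x ≠ 0 := by
    rintro rfl
    simp at hxy
  have hdet : (g.1.1 - 1).det = 0 := Matrix.exists_mulVec_eq_zero_iff.1
    ⟨x, hx0, by rw [Matrix.sub_mulVec, hx, Matrix.one_mulVec, sub_self]⟩
  simp only [Matrix.det_fin_two, Matrix.sub_apply, Matrix.one_apply_eq, ne_eq, zero_ne_one,
    one_ne_zero, not_false_eq_true, Matrix.one_apply_ne] at hdet
  rw [Matrix.trace_fin_two, Matrix.det_fin_two]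
  linear_combination -hdet

theorem exists_norm_le_of_isCompact {K : Set X0} (hK : IsCompact K) :
    ∃ R, ∀ f ∈ K, ∀ x y : Fin 2 → ℝ, f.1 = (RP2.affine x, RP2.affine y) → ‖x‖ ≤ R ∧ ‖y‖ ≤ R := by
  have hcont : Continuous fun f : X0 ↦ f.1 := continuous_subtype_val
  have hbounded {p : X0 → RP2} (hp : Continuous p) (hrange : ∀ f, p f ∈ Set.range RP2.affine) :
      ∃ R, ∀ f ∈ K, ∀ x, p f = RP2.affine x → ‖x‖ ≤ R := by
    have hcompact := (RP2.isOpenEmbedding_affine.isInducing.isCompact_preimage_iff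
      (Set.image_subset_iff.2 fun f _ ↦ hrange f)).2 (hK.image hp)
    obtain ⟨R, hR⟩ := hcompact.isBounded.exists_norm_le
    exact ⟨R, fun f hf x hx ↦ hR x ⟨f, hf, hx⟩⟩
  obtain ⟨R, hR⟩ := hbounded hcont.fst fun f ↦ by
    obtain ⟨x, y, -, hf⟩ := exists_eq_affine f
    exact ⟨x, congrArg Prod.fst hf.symm⟩
  obtain ⟨S, hS⟩ := hbounded hcont.snd fun f ↦ by
    obtain ⟨x, y, -, hf⟩ := exists_eq_affine f
    exact ⟨y, congrArg Prod.snd hf.symm⟩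
  exact ⟨max R S, fun f hfK x y hf ↦
    ⟨(hR f hfK x (congrArg Prod.fst hf)).trans (le_max_left _ _),
      (hS f hfK y (congrArg Prod.snd hf)).trans (le_max_right _ _)⟩⟩

end X0

section Pairing

theorem dotProduct_mulVec_smul_eq {R : Type*} [CommRing R] (A : Matrix (Fin 2) (Fin 2) R)
    (x m : Fin 2 → R) :
    (m ⬝ᵥ A *ᵥ x) • A = Matrix.vecMulVec (A *ᵥ x) (m ᵥ* A) +
      A.det • Matrix.vecMulVec ![m 1, -m 0] ![x 1, -x 0] := by
  ext i j
  simp only [Matrix.add_apply, Matrix.smul_apply, Matrix.vecMulVec_apply, Matrix.det_fin_two,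
    Matrix.mulVec, Matrix.vecMul, dotProduct, Fin.sum_univ_two, smul_eq_mul]
  fin_cases i <;> fin_cases j <;>
    simp only [Fin.zero_eta, Fin.mk_one, Matrix.cons_val_zero, Matrix.cons_val_one] <;> ring

theorem norm_vecMulVec_le {m n : Type*} [Fintype m] [Fintype n] (v : m → ℝ) (w : n → ℝ) :
    ‖Matrix.vecMulVec v w‖ ≤ Fintype.card n * (‖v‖ * ‖w‖) := by
  rw [Matrix.vecMulVec_eq Unit]
  refine (Matrix.linfty_opNorm_mul _ _).trans ?_
  rw [Matrix.linfty_opNorm_replicateCol, Matrix.linfty_opNorm_replicateRow, mul_left_comm]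
  gcongr
  refine (Finset.sum_le_card_nsmul _ _ _ fun i _ ↦ norm_le_pi_norm w i).trans_eq ?_
  rw [nsmul_eq_mul, Finset.card_univ]

theorem norm_le_of_dotProduct_mulVec_eq {A : Matrix (Fin 2) (Fin 2) ℝ} {x m : Fin 2 → ℝ} {R : ℝ}
    (h : m ⬝ᵥ A *ᵥ x = -1) (hx : ‖x‖ ≤ R) (hm : ‖m‖ ≤ R) (hAx : ‖A *ᵥ x‖ ≤ R)
    (hmA : ‖m ᵥ* A‖ ≤ R) : ‖A‖ ≤ 2 * R ^ 2 * (1 + |A.det|) := by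
  have hR : 0 ≤ R := (norm_nonneg _).trans hx
  have hrot (z : Fin 2 → ℝ) : ‖![z 1, -z 0]‖ = ‖z‖ := by
    simp [Pi.norm_def, Fin.univ_succ, sup_comm]
  have hvec {v w : Fin 2 → ℝ} (hv : ‖v‖ ≤ R) (hw : ‖w‖ ≤ R) :
      ‖Matrix.vecMulVec v w‖ ≤ 2 * R ^ 2 := by
    refine (norm_vecMulVec_le v w).trans ?_
    rw [Fintype.card_fin, sq]
    gcongr
    norm_num
  calc ‖A‖ = ‖(m ⬝ᵥ A *ᵥ x) • A‖ := by rw [h, neg_one_smul, norm_neg]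
    _ ≤ 2 * R ^ 2 + |A.det| * (2 * R ^ 2) := by
      rw [dotProduct_mulVec_smul_eq, ← Real.norm_eq_abs]
      refine norm_add_le_of_le (hvec hAx hmA) ((norm_smul_le _ _).trans ?_)
      gcongr
      exact hvec ((hrot m).trans_le hm) ((hrot x).trans_le hx)
    _ = 2 * R ^ 2 * (1 + |A.det|) := by ring

end Pairing

/-! ### Proper discontinuity -/

section Properness

theorem X0.exists_norm_le_mul_one_add_det {K L : Set X0} (hK : IsCompact K) (hL : IsCompact L) :
    ∃ R > 0, ∀ g : GL0, ∀ f ∈ K, g • f ∈ L → ‖g.1.1‖ ≤ R * (1 + g.1.1.det) := by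
  obtain ⟨R, hR⟩ := exists_norm_le_of_isCompact (hK.union hL)
  refine ⟨2 * R ^ 2 + 1, by positivity, fun g f hf hgf ↦ ?_⟩
  obtain ⟨x, y, hxy, hfxy⟩ := exists_eq_affine f
  obtain ⟨hx, hy⟩ := hR f (.inl hf) x y hfxy
  obtain ⟨hgx, hgy⟩ := hR _ (.inr hgf) _ _ (coe_smul_eq_affine g hfxy)
  have hinv : y ᵥ* (g⁻¹).1.1 ᵥ* g.1.1 = y := by
    rw [Matrix.vecMul_vecMul]
    change y ᵥ* (g⁻¹ * g).1.1 = y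
    rw [inv_mul_cancel]
    exact Matrix.vecMul_one y
  have hpair : y ᵥ* (g⁻¹).1.1 ⬝ᵥ g.1.1 *ᵥ x = -1 := by
    rw [Matrix.dotProduct_mulVec, hinv, dotProduct_comm, hxy]
  refine (norm_le_of_dotProduct_mulVec_eq hpair hx hgy hgx (hinv.symm ▸ hy)).trans ?_
  rw [abs_of_pos (GL0.det_pos g)]
  exact mul_le_mul_of_nonneg_right (by linarith) (by linarith [GL0.det_pos g])

theorem add_inv_le_two_mul_exp_abs_log {δ : ℝ} (hδ : 0 < δ) :
    δ + δ⁻¹ ≤ 2 * Real.exp |Real.log δ| := by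
  rw [two_mul]
  gcongr
  · exact (Real.log_le_iff_le_exp hδ).1 (le_abs_self _)
  · exact (Real.log_le_iff_le_exp (inv_pos.2 hδ)).1 (Real.log_inv δ ▸ neg_le_abs _)

theorem norm_unimodularPart_le_mul_exp {g : GL0} {R : ℝ} (hR : 0 ≤ R)
    (hg : ‖g.1.1‖ ≤ R * (1 + g.1.1.det)) :
    ‖(unimodularPart g).1‖ ≤ 2 * R * Real.exp |Real.log √g.1.1.det| := by
  have hδ := sqrt_det_pos g
  calc ‖(unimodularPart g).1‖ = ‖g.1.1‖ / √g.1.1.det := norm_unimodularPart g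
    _ ≤ R * (1 + √g.1.1.det ^ 2) / √g.1.1.det := by
      rw [Real.sq_sqrt (GL0.det_pos g).le]
      gcongr
    _ = R * (√g.1.1.det + (√g.1.1.det)⁻¹) := by
      field_simp
      ring
    _ ≤ R * (2 * Real.exp |Real.log √g.1.1.det|) := by
      gcongr
      exact add_inv_le_two_mul_exp_abs_log hδ
    _ = 2 * R * Real.exp |Real.log √g.1.1.det| := by ring

theorem exists_norm_unimodularPart_le {G : Type*} [Group G] {ρ : G →* GL0}
    (hstable : dualStableNorm ρ < 1 / 2) {R : ℝ} (hR : 0 < R) :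
    ∃ C, ∀ γ, ‖(ρ γ).1.1‖ ≤ R * (1 + (ρ γ).1.1.det) → ‖(unimodularPart (ρ γ)).1‖ ≤ C := by
  have htop : dualStableNorm ρ ≠ ⊤ := hstable.ne_top
  set c := (dualStableNorm ρ).toReal
  have hc : c < 1 / 2 := by
    simpa using (ENNReal.toReal_lt_toReal htop (by simp)).2 hstable
  refine ⟨Real.exp (Real.log (2 * R) / (1 - 2 * c)), fun γ hγ ↦ ?_⟩
  set ν := ‖(unimodularPart (ρ γ)).1‖
  have hν : 0 < ν := by
    rw [norm_pos_iff]
    intro h0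
    simpa [h0] using (unimodularPart (ρ γ)).2
  have hgrowth : Real.log ν ≤ Real.log (2 * R) + |logFactor ρ γ| := by
    rw [← Real.log_exp |logFactor ρ γ|, ← Real.log_mul (by positivity) (Real.exp_ne_zero _)]
    exact Real.log_le_log hν (norm_unimodularPart_le_mul_exp hR.le hγ)
  have hfactor : |logFactor ρ γ| ≤ c * (2 * Real.log ν) :=
    (abs_logFactor_le htop γ).trans (mul_le_mul_of_nonneg_left
      (geodesicLength_le_two_mul_log_norm ρ γ) ENNReal.toReal_nonneg)
  rw [← Real.log_le_iff_le_exp hν, le_div_iff₀ (by linarith)]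
  linarith

variable {Γ : Subgroup SLTilde} [DiscreteTopology Γ] [CompactSpace (SLTilde ⧸ Γ)] {ρ : Γ →* GL0}

theorem IsHyperbolicRep.discreteTopology_range_unimodularPart (hρ : IsHyperbolicRep ρ) :
    DiscreteTopology (unimodularPart.comp ρ).range := by
  set π : Γ →* SL(2, ℝ) := SLTilde.proj.comp Γ.subtype
  have hrange : π.range = Γ.map SLTilde.proj := by
    rw [MonoidHom.range_comp, Subgroup.range_subtype]
  have hcompact := compactSpace_quotient_map Γ SLTilde.continuous_proj SLTilde.proj_surjective
  have hker : SLTilde.proj.ker ≤ Subgroup.center SLTilde := fun p hp ↦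
    SLTilde.mem_center_of_proj_mem_center ((MonoidHom.mem_ker.1 hp).symm ▸ one_mem _)
  have hdiscrete := discreteTopology_map_of_isOpenMap SLTilde.isOpenMap_proj hker Γ
  rw [← hrange] at hcompact hdiscrete
  have hcenter (γ : Γ) : unimodularPart (ρ γ) ∈ Subgroup.center SL(2, ℝ) ↔
      π γ ∈ Subgroup.center SL(2, ℝ) := by
    rw [unimodularPart_mem_center_iff, hρ.map_mem_center_iff, SLTilde.mem_center_iff]
    rfl
  refine discreteTopology_range_of_isHyperbolic (π := π) hcenter fun γ hγ ↦ ?_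
  refine isHyperbolic_unimodularPart_iff.2 (hρ.isHyperbolic fun n hn h ↦ hγ n hn ?_)
  rw [← map_pow]
  exact (SLTilde.mem_center_iff Γ _).1 h

theorem IsHyperbolicRep.finite_setOf_norm_unimodularPart_le (hρ : IsHyperbolicRep ρ)
    (hstable : dualStableNorm ρ ≠ ⊤) (C : ℝ) :
    {g : ρ.range | ‖(unimodularPart g).1‖ ≤ C}.Finite := by
  have := hρ.discreteTopology_range_unimodularPart
  have hK : IsCompact ((↑) ⁻¹' Metric.closedBall (0 : Matrix (Fin 2) (Fin 2) ℝ) C : Set SL(2, ℝ)) :=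
    Matrix.SpecialLinearGroup.isClosedEmbedding_val.isCompact_preimage (isCompact_closedBall 0 C)
  refine .of_finite_image ((finite_inter_of_discreteTopology (unimodularPart.comp ρ).range
    hK).subset ?_) (injective_unimodularPart_comp_subtype hstable).injOn
  rintro _ ⟨⟨_, γ, rfl⟩, hγ, rfl⟩
  exact ⟨⟨γ, rfl⟩, mem_closedBall_zero_iff.2 hγ⟩

end Properness

theorem mainTheorem10 (Γ : Subgroup SLTilde) [DiscreteTopology Γ] [CompactSpace (SLTilde ⧸ Γ)]
    (ρ : Γ →* GL0) (hρ : IsHyperbolicRep ρ) (hstable : dualStableNorm ρ < 1 / 2) :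
    (∀ g ∈ ρ.range, ∀ f : X0, g • f = f → g = 1) ∧ ProperlyDiscontinuousSMul ρ.range X0 := by
  constructor
  · rintro _ ⟨γ, rfl⟩ f hf
    exact hρ.eq_one_of_trace_eq_one_add_det hstable.ne_top (X0.trace_eq_one_add_det_of_smul_eq hf)
  · refine ⟨fun {K L} hK hL ↦ ?_⟩
    obtain ⟨R, hR, hnorm⟩ := X0.exists_norm_le_mul_one_add_det hK hL
    obtain ⟨C, hC⟩ := exists_norm_unimodularPart_le hstable hR
    refine (hρ.finite_setOf_norm_unimodularPart_le hstable.ne_top C).subset ?_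
    rintro ⟨_, γ, rfl⟩ ⟨_, ⟨f, hf, rfl⟩, hfL⟩
    exact hC γ (hnorm _ f hf hfL)
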